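/- Let $\mathbb X$ and $\mathbb A$ be Borel subsets of Polish spaces. Consider a Markov decision process with state space $\mathbb X$ and action space $\mathbb A$: for every $x\in\mathbb X$ a nonempty Borel set $A(x)\subseteq\mathbb A$ of available actions is given such that the graph $\mathrm{Gr}(A)=\{(x,a):x\in\mathbb X,\ a\in A(x)\}$ is Borel in $\mathbb X\times\mathbb A$ and there is a Borel map $\phi:\mathbb X\to\mathbb A$ with $\phi(x)\in A(x)$ for all $x$ (such maps are the stationary policies, and sequences $\phi_0,\phi_1,\dots$ of them are the Markov policies); the one-step cost $c:\mathrm{Gr}(A)\to(-\infty,+\infty]$ is Borel and bounded below; $q(\cdot|x,a)$ is a probability measure on $\mathbb X$ for $(x,a)\in\mathrm{Gr}(A)$, and $q(B|\cdot)$ is Borel on $\mathrm{Gr}(A)$ for every Borel $B\subseteq\mathbb X$. A policy $\pi$ is a sequence of transition probabilities $\pi_n$ from the histories $h_n=(\xi_0,u_0,\dots,u_{n-1},\xi_n)\in(\mathbb X\times\mathbb A)^n\times\mathbb X$ to $\mathbb A$ with $\pi_n(A(\xi_n)|h_n)=1$; with the initial state $x$ it defines a probability $P^\pi_x$ on the trajectories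 $(\xi_0,u_0,\xi_1,u_1,\dots)$, with expectation $\mathbb E^\pi_x$. For $\alpha\ge 0$ and $n=0,1,\dots$ let $$v^\pi_{n,\alpha}(x)=\mathbb E^\pi_x\sum_{i=0}^{n-1}\alpha^i c(\xi_i,u_i),\qquad v_{n,\alpha}(x)=\inf_\pi v^\pi_{n,\alpha}(x),$$ and for $\alpha\in[0,1)$ let $$v^\pi_{\alpha}(x)=\mathbb E^\pi_x\sum_{i=0}^{\infty}\alpha^i c(\xi_i,u_i),\qquad v_{\alpha}(x)=\inf_\pi v^\pi_{\alpha}(x),$$ where the infima are over all policies and $0\cdot\infty=0$. A policy $\pi$ is $n$-horizon optimal if $v^\pi_{n,\alpha}=v_{n,\alpha}$ on $\mathbb X$, and discount-optimal if $v^\pi_\alpha=v_\alpha$ on $\mathbb X$. Put $\eta^\alpha_u(x,a)=c(x,a)+\alpha\int_{\mathbb X}u(y)\,q(dy|x,a)$. Assumption (W*): (1) $c$ is lower semicontinuous on $\mathrm{Gr}(A)$; (2) if $x_n\to x$ in $\mathbb X$, $a_n\in A(x_n)$, and the sequence $c(x_n,a_n)$ is bounded above by a finite constant, then $(a_n)$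 has a limit point $a\in A(x)$; (3) $q$ is weakly continuous on $\mathrm{Gr}(A)$, that is, $(x,a)\mapsto\int f(z)\,q(dz|x,a)$ is continuous on $\mathrm{Gr}(A)$ for every bounded continuous $f:\mathbb X\to\mathbb R$. Assumption (Wu): $c$ is inf-compact on $\mathrm{Gr}(A)$, that is, $\{(x,a)\in\mathrm{Gr}(A):c(x,a)\le\lambda\}$ is compact for every real $\lambda$, and (3) holds. **Theorem.** Let (W*) hold and let $\alpha\ge0$; in (iv), (v) and wherever $v_\alpha$ occurs, let $\alpha\in[0,1)$. (i) The functions $v_{n,\alpha}$ and $v_\alpha$ are lower semicontinuous on $\mathbb X$, and $v_{n,\alpha}(x)\to v_\alpha(x)$ as $n\to\infty$ for all $x\in\mathbb X$. If $c\ge0$, the convergence is monotone: $v_{n,\alpha}(x)\uparrow v_\alpha(x)$. More generally, if $c\ge K$ on $\mathrm{Gr}(A)$ for a real $K$ and $\alpha\in[0,1)$, then $v_{n,\alpha}(x)-K\sum_{i=0}^{n-1}\alpha^i$ is nondecreasing in $n$. (ii) $v_{0,\alpha}=0$, and for all $n=0,1,\dots$ and $x\in\mathbb X$ $$v_{n+1,\alpha}(x)=\min_{a\in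 A(x)}\eta^\alpha_{v_{n,\alpha}}(x,a).$$ The sets $A_{n,\alpha}(x)=\{a\in A(x):v_{n+1,\alpha}(x)=\eta^\alpha_{v_{n,\alpha}}(x,a)\}$ are nonempty; the graph $\{(x,a):x\in\mathbb X,\ a\in A_{n,\alpha}(x)\}$ is a Borel subset of $\mathbb X\times\mathbb A$; $A_{n,\alpha}(x)=A(x)$ if $v_{n+1,\alpha}(x)=+\infty$, and $A_{n,\alpha}(x)$ is compact if $v_{n+1,\alpha}(x)<+\infty$. (iii) For every $N=1,2,\dots$ there is an $N$-horizon optimal Markov policy, and every Markov policy with $\phi_{N-1-n}(x)\in A_{n,\alpha}(x)$ for all $x\in\mathbb X$ and $n=0,\dots,N-1$ is $N$-horizon optimal. (iv) For all $x\in\mathbb X$ $$v_\alpha(x)=\min_{a\in A(x)}\eta^\alpha_{v_\alpha}(x,a).$$ The sets $A_\alpha(x)=\{a\in A(x):v_\alpha(x)=\eta^\alpha_{v_\alpha}(x,a)\}$ are nonempty; the graph $\{(x,a):x\in\mathbb X,\ a\in A_\alpha(x)\}$ is a Borel subset of $\mathbb X\times\mathbb A$; $A_\alpha(x)=A(x)$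 if $v_\alpha(x)=+\infty$, and $A_\alpha(x)$ is compact if $v_\alpha(x)<+\infty$. (v) There is a stationary discount-optimal policy, and a stationary policy $\phi$ is discount-optimal if and only if $\phi(x)\in A_\alpha(x)$ for all $x\in\mathbb X$. (vi) Under (Wu) (even if (W*) is not assumed), the functions $v_{n,\alpha}$, $n=1,2,\dots$, and $v_\alpha$ are inf-compact on $\mathbb X$: the sets $\{x:v_{n,\alpha}(x)\le\lambda\}$ and $\{x:v_\alpha(x)\le\lambda\}$ are compact for all real $\lambda$. -/

import Mathlib

open MeasureTheory ProbabilityTheory Filter Topology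

noncomputable section

/-- The integral `∫ f⁺ dμ - ∫ f⁻ dμ` of an extended-real-valued function. In this file it is used
only for functions that are almost surely bounded below and for probability measures, so that the
second term is finite. -/
def erealIntegral {Ω : Type*} [MeasurableSpace Ω] (μ : Measure Ω) (f : Ω → EReal) : EReal :=
  ((∫⁻ ω, (f ω).toENNReal ∂μ : ENNReal) : EReal) -
    ((∫⁻ ω, (-f ω).toENNReal ∂μ : ENNReal) : EReal)

/-- The graph of a set-valued mapping. -/
def setGraph {X A : Type*} (F : X → Set A) : Set (X × A) := {p | p.2 ∈ F p.1}

/-- A function is inf-compact on `U` if all its level sets in `U` at finite levels are compact. -/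
def InfCompactOn {Y : Type*} [TopologicalSpace Y] (f : Y → EReal) (U : Set Y) : Prop :=
  ∀ l : ℝ, IsCompact {y | y ∈ U ∧ f y ≤ (l : EReal)}

/-- A Markov decision process with state space `X` and action space `A`. The cost and the transition
probability are total functions, but only their values on the graph of `act` are constrained and
used. -/
structure MDP (X A : Type*) [MeasurableSpace X] [MeasurableSpace A] where
  /-- the sets of available actions -/
  act : X → Set A
  act_nonempty : ∀ x, (act x).Nonempty
  act_measurable : ∀ x, MeasurableSet (act x)
  graph_measurable : MeasurableSet (setGraph act)
  exists_selector : ∃ φ : X → A, Measurable φ ∧ ∀ x, φ x ∈ act x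
  /-- the one-step cost, possibly `+∞` -/
  cost : X × A → EReal
  cost_measurable : Measurable fun p : setGraph act => cost p
  cost_bddBelow : ∃ K : ℝ, ∀ p ∈ setGraph act, (K : EReal) ≤ cost p
  /-- the transition probability -/
  q : X × A → Measure X
  q_prob : ∀ p ∈ setGraph act, IsProbabilityMeasure (q p)
  q_measurable : Measurable fun p : setGraph act => q p

/-- Histories `(ξ₀, u₀, …, ξₙ₋₁, uₙ₋₁, ξₙ)` up to time `n`. -/
abbrev History (X A : Type*) (n : ℕ) : Type _ := (Fin n → X × A) × X

namespace MDP

variable {X A : Type*} [MeasurableSpace X] [MeasurableSpace A] (M : MDP X A)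

/-- A (randomized, history-dependent) policy. -/
structure Policy where
  rule : (n : ℕ) → Kernel (History X A n) A
  isMarkov : ∀ n, IsMarkovKernel (rule n)
  rule_act : ∀ n (h : History X A n), rule n h (M.act h.2) = 1

/-- Borel selectors of the action sets, that is, stationary policies. -/
def Selector : Type _ := {φ : X → A // Measurable φ ∧ ∀ x, φ x ∈ M.act x}

/-- The policy given by a Markov policy `φ₀, φ₁, …`. -/
def markovPolicy (φ : ℕ → M.Selector) : M.Policy where
  rule n := Kernel.deterministic (fun h : History X A n => (φ n).1 h.2)
    ((φ n).2.1.comp measurable_snd)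
  isMarkov n := inferInstance
  rule_act n h := by
    rw [Kernel.deterministic_apply, Measure.dirac_apply' _ (M.act_measurable h.2)]
    exact Set.indicator_of_mem ((φ n).2.2 h.2) _

/-- The policy given by a stationary policy `φ`. -/
def stationaryPolicy (φ : M.Selector) : M.Policy := M.markovPolicy fun _ => φ

open Classical in
/-- The transition probability as a kernel on all of `X × A`. Outside the graph of the action sets,
which the process almost surely never leaves, the state is left unchanged. -/
def transKernel : Kernel (X × A) X where
  toFun p := if p ∈ setGraph M.act then M.q p else Measure.dirac p.1
  measurable' := by
    refine measurable_of_restrict_of_restrict_compl M.graph_measurable ?_ ?_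
    · convert M.q_measurable using 1
      funext p
      simp only [Set.domRestrict_apply]
      exact if_pos p.2
    · have h : Measurable fun p : ((setGraph M.act)ᶜ : Set (X × A)) =>
          Measure.dirac (p : X × A).1 :=
        Measure.measurable_dirac.comp (measurable_fst.comp measurable_subtype_coe)
      convert h using 1
      funext p
      simp only [Set.domRestrict_apply]
      exact if_neg p.2

open Classical in
instance : IsMarkovKernel M.transKernel where
  isProbabilityMeasure p := by
    change IsProbabilityMeasure (if p ∈ setGraph M.act then M.q p else Measure.dirac p.1)
    split_ifs with h
    · exact M.q_prob p h
    · infer_instance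

variable {M}

/-- The history at time `n + 1` made of the state-action pairs up to time `n` and the next state. -/
def nextHistory (n : ℕ) (z : ((_ : Finset.Iic n) → X × A) × X) : History X A (n + 1) :=
  (fun i => z.1 ⟨i.1, Finset.mem_Iic.2 (Nat.lt_succ_iff.1 i.2)⟩, z.2)

theorem measurable_nextHistory (n : ℕ) : Measurable (nextHistory (X := X) (A := A) n) := by
  unfold nextHistory
  fun_prop

/-- Given the state-action pairs up to time `n`, the next state is drawn from the transition
probability and the next action from the decision rule at time `n + 1`. -/
def stepKernel (π : M.Policy) (n : ℕ) : Kernel ((_ : Finset.Iic n) → X × A) (X × A) :=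
  (M.transKernel.comap (fun z => z ⟨n, Finset.mem_Iic.2 le_rfl⟩) (measurable_pi_apply _)) ⊗ₖ
    ((π.rule (n + 1)).comap (nextHistory n) (measurable_nextHistory n))

instance (π : M.Policy) (n : ℕ) : IsMarkovKernel (stepKernel π n) := by
  have := π.isMarkov (n + 1)
  unfold stepKernel
  infer_instance

/-- The law of the first state-action pair for the initial state `x`. -/
def initLaw (π : M.Policy) (x : X) : Measure (X × A) :=
  (π.rule 0 (Fin.elim0, x)).map fun a => (x, a)

/-- The law of the trajectory `(ξ₀, u₀), (ξ₁, u₁), …` for the policy `π` and the initial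
state `x`. -/
def law (π : M.Policy) (x : X) : Measure (ℕ → X × A) :=
  Kernel.trajMeasure (X := fun _ => X × A) (initLaw π x) (stepKernel π)

/-- The expected total discounted cost of `π` over the horizon `N`. -/
def costN (α : ℝ) (N : ℕ) (π : M.Policy) (x : X) : EReal :=
  erealIntegral (law π x) fun ω => ∑ n ∈ Finset.range N, ((α ^ n : ℝ) : EReal) * M.cost (ω n)

/-- The expected total discounted cost of `π` over the infinite horizon. -/
def costInf (α : ℝ) (π : M.Policy) (x : X) : EReal :=
  erealIntegral (law π x) fun ω => ∑' n : ℕ, ((α ^ n : ℝ) : EReal) * M.cost (ω n)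

variable (M)

/-- The optimal cost over the horizon `N`. -/
def valueN (α : ℝ) (N : ℕ) (x : X) : EReal := ⨅ π : M.Policy, costN α N π x

/-- The optimal discounted cost over the infinite horizon. -/
def valueInf (α : ℝ) (x : X) : EReal := ⨅ π : M.Policy, costInf α π x

variable {M}

def IsHorizonOptimal (α : ℝ) (N : ℕ) (π : M.Policy) : Prop :=
  ∀ x, costN α N π x = M.valueN α N x

def IsDiscountOptimal (α : ℝ) (π : M.Policy) : Prop :=
  ∀ x, costInf α π x = M.valueInf α x

variable (M)

/-- `η_u^α(x, a) = c(x, a) + α ∫ u(y) q(dy | x, a)`. -/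
def eta (α : ℝ) (u : X → EReal) (x : X) (a : A) : EReal :=
  M.cost (x, a) + (α : EReal) * erealIntegral (M.q (x, a)) u

/-- The optimal actions when `n + 1` steps remain. -/
def argminN (α : ℝ) (n : ℕ) (x : X) : Set A :=
  {a | a ∈ M.act x ∧ M.valueN α (n + 1) x = M.eta α (M.valueN α n) x a}

/-- The optimal actions over the infinite horizon. -/
def argminInf (α : ℝ) (x : X) : Set A :=
  {a | a ∈ M.act x ∧ M.valueInf α x = M.eta α (M.valueInf α) x a}

section Assumptions

variable [TopologicalSpace X] [TopologicalSpace A]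

/-- Weak continuity of the transition probability on the graph of the action sets. -/
def WeaklyContinuous : Prop :=
  ∀ f : BoundedContinuousFunction X ℝ,
    ContinuousOn (fun p : X × A => ∫ z, f z ∂(M.q p)) (setGraph M.act)

/-- Assumption (W*). Boundedness below of the cost is already part of the model. -/
structure AssumptionWStar : Prop where
  lsc : LowerSemicontinuousOn M.cost (setGraph M.act)
  limitPoint : ∀ (x : ℕ → X) (x' : X), Tendsto x atTop (𝓝 x') →
    ∀ a : ℕ → A, (∀ n, a n ∈ M.act (x n)) →
      (∃ L : ℝ, ∀ n, M.cost (x n, a n) ≤ (L : EReal)) →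
        ∃ a' ∈ M.act x', MapClusterPt a' atTop a
  weaklyContinuous : M.WeaklyContinuous

/-- Assumption (Wu). -/
structure AssumptionWu : Prop where
  infCompact : InfCompactOn M.cost (setGraph M.act)
  weaklyContinuous : M.WeaklyContinuous

end Assumptions

end MDP

end

noncomputable section

/-! ### Integrals of lower semicontinuous functions against weakly convergent measures -/

/-! Subtracting a lower bound `K` from the cost changes the cost of every policy by the same finite
constant, so optimal values, minimizers and optimal policies can be studied for a `[0, ∞]`-valued
cost, where integrability is never an issue; `shiftEReal` carries the results back.

For such costs, (W*) becomes `KInfCompact`: lower semicontinuity, and accumulation of actions with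
bounded cost along convergent states. Adding a discounted integral of a nonnegative lower
semicontinuous `u` preserves it: by weak continuity that integral is lower semicontinuous, and a
larger function has fewer sequences with bounded values. `KInfCompact` yields attained minima, lower
semicontinuous infima, compact sets of minimizers where the infimum is finite, and Borel selectors
of minimizers.

Integrating the one-step inequality along the trajectory of any policy shows that value iteration
from zero bounds its cost from below; selected minimizers give equality. The iterates increase to
`limValue`. At a fixed state, minimizers of the successive iterates accumulate at an action
attaining the optimality equation for the limit (`limValue_eq_iInf`). A stationary policy of
minimizers then costs at most `limValue`, which bounds every policy from below. Conversely, an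
optimal stationary policy must use minimizers, because its cost is at least its first-stage cost
plus the discounted optimal continuation.

Under (Wu), which implies (W*), a value at least as large as a shifted cost at some action has its
sublevel sets inside projections of compact sets. -/

theorem lintegral_ofReal_le_liminf_of_lowerSemicontinuous {Ω ι : Type*} [MeasurableSpace Ω]
    [TopologicalSpace Ω] [OpensMeasurableSpace Ω] {L : Filter ι} [L.IsCountablyGenerated]
    {μ : Measure Ω} {μs : ι → Measure Ω} {f : Ω → ℝ} (hf : LowerSemicontinuous f) (hf0 : 0 ≤ f)
    (hopen : ∀ G, IsOpen G → μ G ≤ L.liminf fun i => μs i G) :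
    ∫⁻ x, ENNReal.ofReal (f x) ∂μ ≤ L.liminf fun i => ∫⁻ x, ENNReal.ofReal (f x) ∂(μs i) := by
  -- Layer cake: the superlevel sets are open, so `hopen` applies at each level, and Fatou's lemma
  -- applies in the level variable.
  simp_rw [lintegral_eq_lintegral_meas_lt _ (Eventually.of_forall hf0) hf.measurable.aemeasurable]
  exact (lintegral_mono fun t => hopen _ (hf.isOpen_preimage t)).trans
    (lintegral_liminf_le fun n => Antitone.measurable fun s t hst =>
      measure_mono fun ω hω => lt_of_le_of_lt hst hω)

/-- The portmanteau inequality for open sets handles the finite truncations `min u n`; by monotone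
convergence the full integral is a supremum of lower semicontinuous functions. -/
theorem lowerSemicontinuous_lintegral_of_continuous {Y Ω : Type*} [TopologicalSpace Y]
    [FirstCountableTopology Y] [TopologicalSpace Ω] [MeasurableSpace Ω] [OpensMeasurableSpace Ω]
    [HasOuterApproxClosed Ω] {μ : Y → ProbabilityMeasure Ω} (hμ : Continuous μ)
    {u : Ω → ENNReal} (hu : LowerSemicontinuous u) :
    LowerSemicontinuous fun y => ∫⁻ x, u x ∂(μ y : Measure Ω) := by
  have htrunc : ∀ n : ℕ, LowerSemicontinuous
      fun y => ∫⁻ x, ENNReal.ofReal (min (u x) n).toReal ∂(μ y : Measure Ω) := by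
    intro n
    have hlsc : LowerSemicontinuous fun x => (min (u x) n).toReal := by
      intro x t ht
      rcases lt_or_ge t 0 with h | h
      · exact Eventually.of_forall fun _ => h.trans_le ENNReal.toReal_nonneg
      · have hmin : LowerSemicontinuous fun x => min (u x) (n : ENNReal) :=
          hu.inf lowerSemicontinuous_const
        have hne : ∀ x, min (u x) (n : ENNReal) ≠ ⊤ := fun x =>
          ne_top_of_le_ne_top (ENNReal.natCast_ne_top n) (min_le_right _ _)
        have := hmin x _ ((ENNReal.ofReal_lt_iff_lt_toReal h (hne x)).2 ht)
        filter_upwards [this] with z hz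
        exact (ENNReal.ofReal_lt_iff_lt_toReal h (hne z)).1 hz
    rw [lowerSemicontinuous_iff_le_liminf]
    intro y
    exact lintegral_ofReal_le_liminf_of_lowerSemicontinuous hlsc
      (fun _ => ENNReal.toReal_nonneg)
      fun G hG => ProbabilityMeasure.le_liminf_measure_open_of_tendsto hμ.continuousAt hG
  have hsup : (fun y => ∫⁻ x, u x ∂(μ y : Measure Ω)) =
      fun y => ⨆ n : ℕ, ∫⁻ x, ENNReal.ofReal (min (u x) n).toReal ∂(μ y : Measure Ω) := by
    funext y
    have hne : ∀ (n : ℕ) x, ENNReal.ofReal (min (u x) (n : ENNReal)).toReal = min (u x) n :=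
      fun n x => ENNReal.ofReal_toReal
        (ne_top_of_le_ne_top (ENNReal.natCast_ne_top n) (min_le_right _ _))
    simp_rw [hne]
    rw [← lintegral_iSup (fun n => hu.measurable.min measurable_const)
      (fun n m hnm x => min_le_min le_rfl (by exact_mod_cast hnm))]
    congr 1 with x
    rw [← inf_iSup_eq, ENNReal.iSup_natCast, inf_top_eq]
  rw [hsup]
  exact lowerSemicontinuous_iSup htrunc

/-! ### Measurable selection for compact-valued mappings -/

/-- One refinement step of the Kuratowski–Ryll-Nardzewski construction. Taking the least index of a
ball that meets `Φ x` is measurable, and the hitting condition survives because a closed ball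
intersected with `F` is closed. -/
theorem exists_measurable_nat_inter_closedBall {X A : Type*} [MeasurableSpace X] [MetricSpace A]
    {d : ℕ → A} (hd : DenseRange d) {Φ : X → Set A} (hne : ∀ x, (Φ x).Nonempty)
    (hm : ∀ F, IsClosed F → MeasurableSet {x | (Φ x ∩ F).Nonempty}) {r : ℝ} (hr : 0 < r) :
    ∃ k : X → ℕ, Measurable k ∧
      (∀ x, (Φ x ∩ Metric.closedBall (d (k x)) r).Nonempty) ∧
      ∀ F, IsClosed F →
        MeasurableSet {x | ((Φ x ∩ Metric.closedBall (d (k x)) r) ∩ F).Nonempty} := by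
  classical
  have hex : ∀ x, ∃ k, (Φ x ∩ Metric.closedBall (d k) r).Nonempty := by
    intro x
    obtain ⟨y, hy⟩ := hne x
    obtain ⟨k, hk⟩ := hd.exists_dist_lt y hr
    exact ⟨k, y, hy, hk.le⟩
  have hk : Measurable fun x => Nat.find (hex x) :=
    measurable_find hex fun k => hm _ Metric.isClosed_closedBall
  refine ⟨_, hk, fun x => Nat.find_spec (hex x), fun F hF => ?_⟩
  have : {x | ((Φ x ∩ Metric.closedBall (d (Nat.find (hex x))) r) ∩ F).Nonempty} =
      ⋃ k : ℕ, (fun x => Nat.find (hex x)) ⁻¹' {k} ∩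
        {x | (Φ x ∩ (Metric.closedBall (d k) r ∩ F)).Nonempty} := by
    ext x
    simp only [Set.inter_assoc, Set.mem_iUnion, Set.mem_inter_iff, Set.mem_preimage,
      Set.mem_singleton_iff, Set.mem_ofPred_eq]
    exact ⟨fun h => ⟨_, rfl, h⟩, fun ⟨k, hk, h⟩ => by rw [hk]; exact h⟩
  rw [this]
  exact MeasurableSet.iUnion fun k => (hk (measurableSet_singleton k)).inter
    (hm _ (Metric.isClosed_closedBall.inter hF))

/-- Refining with radii `2⁻ⁿ` gives nested closed sets, and the chosen centers converge to a point
of their intersection. Compactness of `Φ x` makes that intersection nonempty, so the metric need not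
be complete. -/
theorem exists_measurable_selector_of_isCompact {X A : Type*} [MeasurableSpace X]
    [TopologicalSpace A] [TopologicalSpace.MetrizableSpace A] [SecondCountableTopology A]
    [MeasurableSpace A] [BorelSpace A] {Φ : X → Set A} (hne : ∀ x, (Φ x).Nonempty)
    (hc : ∀ x, IsCompact (Φ x))
    (hm : ∀ F, IsClosed F → MeasurableSet {x | (Φ x ∩ F).Nonempty}) :
    ∃ φ : X → A, Measurable φ ∧ ∀ x, φ x ∈ Φ x := by
  classical
  let _ : MetricSpace A := TopologicalSpace.metrizableSpaceMetric A
  rcases isEmpty_or_nonempty X with hX | ⟨⟨x₀⟩⟩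
  · exact ⟨fun x => (hX.false x).elim, measurable_of_empty _, fun x => (hX.false x).elim⟩
  have : Nonempty A := ⟨(hne x₀).some⟩
  obtain ⟨d, hd⟩ := TopologicalSpace.exists_dense_seq A
  let r : ℕ → ℝ := fun n => (1 / 2 : ℝ) ^ n
  have hr : ∀ n, 0 < r n := fun n => by positivity
  let S := {Ψ : X → Set A // (∀ x, (Ψ x).Nonempty) ∧
    ∀ F, IsClosed F → MeasurableSet {x | (Ψ x ∩ F).Nonempty}}
  choose k hk hkne hkm using fun (n : ℕ) (Ψ : S) =>
    exists_measurable_nat_inter_closedBall hd Ψ.2.1 Ψ.2.2 (hr n)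
  let Ψ : ℕ → S := fun n => Nat.rec ⟨Φ, hne, hm⟩ (fun n Ψ => ⟨_, hkne n Ψ, hkm n Ψ⟩) n
  have hsucc : ∀ n x, (Ψ (n + 1)).1 x =
      (Ψ n).1 x ∩ Metric.closedBall (d (k n (Ψ n) x)) (r n) := fun _ _ => rfl
  have hclosed : ∀ n x, IsClosed ((Ψ n).1 x) := by
    intro n x
    induction n with
    | zero => exact (hc x).isClosed
    | succ n ih => rw [hsucc]; exact ih.inter Metric.isClosed_closedBall
  have hinter : ∀ x, (⋂ n, (Ψ n).1 x).Nonempty := fun x =>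
    IsCompact.nonempty_iInter_of_sequence_nonempty_isCompact_isClosed _
      (fun n => by rw [hsucc]; exact Set.inter_subset_left) (fun n => (Ψ n).2.1 x) (hc x)
      (fun n => hclosed n x)
  choose φ hφ using hinter
  have hφ' : ∀ x n, φ x ∈ (Ψ n).1 x := fun x n => Set.mem_iInter.1 (hφ x) n
  refine ⟨φ, ?_, fun x => hφ' x 0⟩
  refine measurable_of_tendsto_metrizable (f := fun n x => d (k n (Ψ n) x))
    (fun n => (measurable_from_nat (f := d)).comp (hk n (Ψ n))) ?_
  rw [tendsto_pi_nhds]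
  intro x
  rw [tendsto_iff_dist_tendsto_zero]
  refine squeeze_zero (fun _ => dist_nonneg) (fun n => ?_)
    (tendsto_pow_atTop_nhds_zero_of_lt_one (by norm_num : (0 : ℝ) ≤ 1 / 2) (by norm_num))
  have := hφ' x (n + 1)
  rw [hsucc] at this
  rw [dist_comm]
  exact this.2

/-! ### Minimization of functions that are inf-compact in the second variable, locally uniformly
in the first one -/

/-- Lower semicontinuous functions on the graph of `act` for which actions with bounded values along
a convergent sequence of states accumulate at an available action. -/
structure KInfCompact {X A : Type*} [TopologicalSpace X] [TopologicalSpace A] (act : X → Set A)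
    (f : X × A → ENNReal) : Prop where
  lsc : LowerSemicontinuousOn f (setGraph act)
  limitPoint : ∀ (x : ℕ → X) (x' : X), Tendsto x atTop (𝓝 x') →
    ∀ a : ℕ → A, (∀ n, a n ∈ act (x n)) →
      ∀ L : ENNReal, L ≠ ⊤ → (∀ n, f (x n, a n) ≤ L) → ∃ a' ∈ act x', MapClusterPt a' atTop a

namespace KInfCompact

variable {X A : Type*} [TopologicalSpace X] [TopologicalSpace A] {act : X → Set A}
  {f : X × A → ENNReal}

theorem of_le (hf : KInfCompact act f) {g : X × A → ENNReal}
    (hg : LowerSemicontinuousOn g (setGraph act)) (hle : ∀ p ∈ setGraph act, f p ≤ g p) :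
    KInfCompact act g where
  lsc := hg
  limitPoint x x' hx a ha L hL hb :=
    hf.limitPoint x x' hx a ha L hL fun n => (hle (x n, a n) (ha n)).trans (hb n)

/-- This lets the event that some minimizer lies in `F` be expressed by comparing two lower
semicontinuous infima. -/
theorem inter_isClosed (hf : KInfCompact act f) {F : Set A} (hF : IsClosed F) :
    KInfCompact (fun x => act x ∩ F) f where
  lsc := hf.lsc.mono fun _ hp => hp.1
  limitPoint x x' hx a ha L hL hb := by
    obtain ⟨a', ha', hcl⟩ := hf.limitPoint x x' hx a (fun n => (ha n).1) L hL hb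
    refine ⟨a', ⟨ha', ?_⟩, hcl⟩
    by_contra hn
    obtain ⟨n, hn⟩ := (hcl.frequently (hF.isOpen_compl.mem_nhds hn)).exists
    exact hn (ha n).2

/-- The value at an accumulation point of the actions is at most any eventual bound. -/
theorem le_of_mapClusterPt (hf : LowerSemicontinuousOn f (setGraph act)) {x : ℕ → X} {x' : X}
    (hx : Tendsto x atTop (𝓝 x')) {a : ℕ → A} (ha : ∀ n, a n ∈ act (x n)) {a' : A}
    (ha' : a' ∈ act x') (hcl : MapClusterPt a' atTop a) {L : ENNReal}
    (hb : ∀ᶠ n in atTop, f (x n, a n) ≤ L) : f (x', a') ≤ L := by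
  by_contra! hlt
  have hev := hf (x', a') ha' L hlt
  rw [eventually_nhdsWithin_iff, nhds_prod_eq] at hev
  obtain ⟨P, hP, Q, hQ, hPQ⟩ := eventually_prod_iff.1 hev
  obtain ⟨n, hn, hn1, hn2⟩ := ((hcl.frequently hQ).and_eventually ((hx.eventually hP).and hb)).exists
  exact absurd hn2 (not_le.2 (hPQ hn1 hn (ha n)))

theorem exists_isMinOn (hf : KInfCompact act f) {x : X} (hne : (act x).Nonempty) :
    ∃ a ∈ act x, ∀ b ∈ act x, f (x, a) ≤ f (x, b) := by
  by_cases htop : ∀ b ∈ act x, f (x, b) = ⊤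
  · obtain ⟨a, ha⟩ := hne
    exact ⟨a, ha, fun b hb => by rw [htop b hb]; exact le_top⟩
  push Not at htop
  obtain ⟨b₀, hb₀, hb₀'⟩ := htop
  set m := ⨅ b ∈ act x, f (x, b) with hm
  have hmt : m ≠ ⊤ := ne_top_of_le_ne_top hb₀' (iInf₂_le b₀ hb₀)
  have hex : ∀ n : ℕ, ∃ a ∈ act x, f (x, a) < m + ((n : ENNReal) + 1)⁻¹ := by
    intro n
    have : m < m + ((n : ENNReal) + 1)⁻¹ := ENNReal.lt_add_right hmt (by simp)
    rw [hm] at this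
    obtain ⟨a, ha⟩ := iInf_lt_iff.1 this
    obtain ⟨ha', h⟩ := iInf_lt_iff.1 ha
    exact ⟨a, ha', h⟩
  choose a ha hlt using hex
  -- The minimizing sequence has values below `m + 1`, since its errors are at most one.
  obtain ⟨a', ha', hcl⟩ := hf.limitPoint (fun _ => x) x tendsto_const_nhds a ha (m + 1)
    (by simp [hmt]) fun n => (hlt n).le.trans (by gcongr; simp)
  refine ⟨a', ha', fun b hb => ?_⟩
  refine le_trans ?_ (show m ≤ f (x, b) from iInf₂_le b hb)
  refine le_of_forall_gt_imp_ge_of_dense fun L hL => ?_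
  refine le_of_mapClusterPt hf.lsc tendsto_const_nhds ha ha' hcl ?_
  have hlim : Tendsto (fun n : ℕ => m + ((n : ENNReal) + 1)⁻¹) atTop (𝓝 m) := by
    have h1 : Tendsto (fun n : ℕ => ((n : ENNReal) + 1)⁻¹) atTop (𝓝 0) := by
      have := (tendsto_add_atTop_iff_nat 1).2 ENNReal.tendsto_inv_nat_nhds_zero
      simpa using this
    simpa using tendsto_const_nhds.add h1
  filter_upwards [hlim.eventually_lt_const hL] with n hn
  exact (hlt n).le.trans hn.le

theorem lowerSemicontinuous_iInf [FirstCountableTopology X] (hf : KInfCompact act f) :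
    LowerSemicontinuous fun x => ⨅ a ∈ act x, f (x, a) := by
  intro x y hy
  -- An infimum at most `y` need not be attained by a value at most `y`; the strictly larger, finite
  -- level `L` provides actual actions below it.
  obtain ⟨L, hyL, hL⟩ := exists_between hy
  by_contra hcon
  rw [not_eventually] at hcon
  obtain ⟨xs, hxs, hle⟩ := exists_seq_forall_of_frequently hcon
  have hex : ∀ n, ∃ a ∈ act (xs n), f (xs n, a) < L := by
    intro n
    obtain ⟨a, ha⟩ := iInf_lt_iff.1 ((not_lt.1 (hle n)).trans_lt hyL)
    obtain ⟨ha', h⟩ := iInf_lt_iff.1 ha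
    exact ⟨a, ha', h⟩
  choose a ha hlt using hex
  obtain ⟨a', ha', hcl⟩ := hf.limitPoint xs x hxs a ha L (ne_top_of_lt hL) fun n => (hlt n).le
  have := le_of_mapClusterPt hf.lsc hxs ha ha' hcl (Eventually.of_forall fun n => (hlt n).le)
  exact absurd (hL.trans_le (iInf₂_le a' ha')) (not_lt.2 this)

theorem isCompact_sublevel [TopologicalSpace.PseudoMetrizableSpace A] (hf : KInfCompact act f)
    (x : X) {L : ENNReal} (hL : L ≠ ⊤) : IsCompact {a | a ∈ act x ∧ f (x, a) ≤ L} := by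
  refine IsSeqCompact.isCompact fun a ha => ?_
  obtain ⟨a', ha', hcl⟩ := hf.limitPoint (fun _ => x) x tendsto_const_nhds a (fun n => (ha n).1) L
    hL fun n => (ha n).2
  obtain ⟨ψ, hψ, hlim⟩ := MapClusterPt.tendsto_subseq hcl
  exact ⟨a', ⟨ha', le_of_mapClusterPt hf.lsc tendsto_const_nhds (fun n => (ha n).1) ha' hcl
    (Eventually.of_forall fun n => (ha n).2)⟩, ψ, hψ, hlim⟩

/-- There is a Borel selector of minimizers. -/
theorem exists_measurable_argmin [FirstCountableTopology X] [MeasurableSpace X]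
    [OpensMeasurableSpace X] [TopologicalSpace.MetrizableSpace A] [SecondCountableTopology A]
    [MeasurableSpace A] [BorelSpace A] (hf : KInfCompact act f)
    (hsel : ∃ φ : X → A, Measurable φ ∧ ∀ x, φ x ∈ act x) :
    ∃ φ : X → A, Measurable φ ∧
      ∀ x, φ x ∈ act x ∧ f (x, φ x) = ⨅ a ∈ act x, f (x, a) := by
  obtain ⟨φ₀, hφ₀, hφ₀'⟩ := hsel
  set v : X → ENNReal := fun x => ⨅ a ∈ act x, f (x, a) with hv
  have hvm : Measurable v := hf.lowerSemicontinuous_iInf.measurable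
  classical
  -- Where the infimum is infinite every action is a minimizer and the set of them need not be
  -- compact, so the given selector is used there.
  let Φ : X → Set A := fun x => if v x = ⊤ then {φ₀ x} else {a | a ∈ act x ∧ f (x, a) ≤ v x}
  have htop : MeasurableSet {x | v x = ⊤} := hvm (measurableSet_singleton ⊤)
  have key : ∃ φ : X → A, Measurable φ ∧ ∀ x, φ x ∈ Φ x := by
    refine exists_measurable_selector_of_isCompact (fun x => ?_) (fun x => ?_) fun F hF => ?_
    · by_cases hx : v x = ⊤
      · simp [Φ, hx]
      · simp only [Φ, hx, if_false]
        obtain ⟨a, ha, hmin⟩ := hf.exists_isMinOn ⟨_, hφ₀' x⟩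
        exact ⟨a, ha, le_iInf₂ hmin⟩
    · by_cases hx : v x = ⊤
      · simp [Φ, hx]
      · simp only [Φ, hx, if_false]
        exact hf.isCompact_sublevel x hx
    · have hF' := hf.inter_isClosed hF
      have : {x | (Φ x ∩ F).Nonempty} = ({x | v x = ⊤} ∩ φ₀ ⁻¹' F) ∪
          ({x | v x = ⊤}ᶜ ∩ {x | ⨅ a ∈ act x ∩ F, f (x, a) ≤ v x}) := by
        ext x
        by_cases hx : v x = ⊤
        · simp [Φ, hx]
        · simp only [Φ, hx, if_false, Set.mem_union, Set.mem_inter_iff, Set.mem_ofPred_eq,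
            Set.mem_compl_iff, false_and, false_or, not_false_eq_true, true_and]
          constructor
          · rintro ⟨a, ⟨ha, hle⟩, haF⟩
            exact (iInf₂_le a ⟨ha, haF⟩).trans hle
          · intro hle
            have hne : (act x ∩ F).Nonempty := by
              by_contra hemp
              rw [Set.not_nonempty_iff_eq_empty] at hemp
              have hle' : ⨅ a ∈ act x ∩ F, f (x, a) ≤ v x := hle
              rw [hemp] at hle'
              simp [hx] at hle'
            obtain ⟨a, ha, hmin⟩ := hF'.exists_isMinOn hne
            exact ⟨a, ⟨ha.1, (le_iInf₂ hmin).trans hle⟩, ha.2⟩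
      rw [this]
      exact (htop.inter (hφ₀ hF.measurableSet)).union
        (htop.compl.inter (measurableSet_le hF'.lowerSemicontinuous_iInf.measurable hvm))
  obtain ⟨φ, hφ, hφ'⟩ := key
  refine ⟨φ, hφ, fun x => ?_⟩
  have h := hφ' x
  by_cases hx : v x = ⊤
  · simp only [Φ, hx, if_true, Set.mem_singleton_iff] at h
    rw [h]
    refine ⟨hφ₀' x, le_antisymm ?_ (iInf₂_le _ (hφ₀' x))⟩
    change _ ≤ v x
    rw [hx]; exact le_top
  · simp only [Φ, hx, if_false] at h
    exact ⟨h.1, le_antisymm h.2 (iInf₂_le _ h.1)⟩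

end KInfCompact

/-! ### The law of the trajectory -/

namespace MDP

variable {X A : Type*} [MeasurableSpace X] [MeasurableSpace A] {M : MDP X A}

instance isProbabilityMeasure_initLaw (π : M.Policy) (x : X) :
    IsProbabilityMeasure (initLaw π x) := by
  have := π.isMarkov 0
  exact Measure.isProbabilityMeasure_map (by fun_prop)

instance isProbabilityMeasure_law (π : M.Policy) (x : X) : IsProbabilityMeasure (law π x) := by
  unfold law
  infer_instance

theorem map_eval_zero_law (π : M.Policy) (x : X) :
    (law π x).map (fun ω => ω 0) = initLaw π x := by
  have hfac : (fun ω : ℕ → X × A => ω 0) =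
      (MeasurableEquiv.piUnique fun _ : Finset.Iic 0 => X × A) ∘
        Preorder.frestrictLe (π := fun _ => X × A) 0 := rfl
  rw [hfac, ← Measure.map_map (MeasurableEquiv.measurable _) (by fun_prop), law,
    Kernel.trajMeasure, Measure.map_comp _ _ (by fun_prop), Kernel.traj_map_frestrictLe,
    Kernel.partialTraj_self, Measure.id_comp,
    Measure.map_map (MeasurableEquiv.measurable _) (MeasurableEquiv.measurable _)]
  exact Measure.map_id

theorem lintegral_law_zero (π : M.Policy) (x : X) {g : X × A → ENNReal} (hg : Measurable g) :
    ∫⁻ ω, g (ω 0) ∂(law π x) = ∫⁻ a, g (x, a) ∂(π.rule 0 (Fin.elim0, x)) := by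
  rw [← lintegral_map (μ := law π x) hg (measurable_pi_apply 0), map_eval_zero_law, initLaw,
    lintegral_map hg (by fun_prop)]

/-- The joint law of the past and the next pair is a composition-product with `stepKernel`, which
itself draws the state and then the action. -/
theorem lintegral_law_succ (π : M.Policy) (x : X) (n : ℕ) {g : X × A → ENNReal}
    (hg : Measurable g) :
    ∫⁻ ω, g (ω (n + 1)) ∂(law π x) =
      ∫⁻ ω, ∫⁻ y, ∫⁻ a, g (y, a)
        ∂(π.rule (n + 1) (nextHistory n (Preorder.frestrictLe (π := fun _ => X × A) n ω, y)))
          ∂(M.transKernel (ω n)) ∂(law π x) := by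
  have := π.isMarkov (n + 1)
  have hstep := Kernel.map_frestrictLe_trajMeasure_compProd_eq_map_trajMeasure
    (X := fun _ => X × A) (μ₀ := initLaw π x) (κ := stepKernel π) (a := n)
  have hg' : Measurable fun p : ((_ : Finset.Iic n) → X × A) × (X × A) => g p.2 :=
    hg.comp measurable_snd
  have h1 : ∫⁻ ω, g (ω (n + 1)) ∂(law π x) = ∫⁻ p, g p.2 ∂((law π x).map fun ω =>
      (Preorder.frestrictLe (π := fun _ => X × A) n ω, ω (n + 1))) := by
    rw [lintegral_map hg' (by fun_prop)]
  rw [h1]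
  unfold law
  rw [← hstep, Measure.lintegral_compProd hg', lintegral_map hg'.lintegral_kernel_prod_right'
    (by fun_prop)]
  refine lintegral_congr fun ω => ?_
  rw [stepKernel, Kernel.lintegral_compProd _ _ _ hg]
  rfl

theorem lintegral_law_succ_fst (π : M.Policy) (x : X) (n : ℕ) {f : X → ENNReal}
    (hf : Measurable f) :
    ∫⁻ ω, f (ω (n + 1)).1 ∂(law π x) =
      ∫⁻ ω, ∫⁻ y, f y ∂(M.transKernel (ω n)) ∂(law π x) := by
  have := π.isMarkov (n + 1)
  rw [lintegral_law_succ π x n (g := fun p => f p.1) (hf.comp measurable_fst)]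
  simp

theorem lintegral_law_zero_fst (π : M.Policy) (x : X) {f : X → ENNReal} (hf : Measurable f) :
    ∫⁻ ω, f (ω 0).1 ∂(law π x) = f x := by
  have := π.isMarkov 0
  rw [lintegral_law_zero π x (g := fun p => f p.1) (hf.comp measurable_fst)]
  simp

/-- Conditionally on the history, leaving `S` has probability zero. This covers both staying in the
graph and following a selector. -/
theorem ae_law_mem (π : M.Policy) (x : X) (n : ℕ) {S : Set (X × A)} (hS : MeasurableSet S)
    (h : ∀ h : History X A n, π.rule n h {a | (h.2, a) ∈ S} = 1) : ∀ᵐ ω ∂(law π x), ω n ∈ S := by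
  have hzero : ∀ h' : History X A n,
      ∫⁻ a, Sᶜ.indicator 1 (h'.2, a) ∂(π.rule n h') = 0 := by
    intro h'
    have := π.isMarkov n
    have hm : MeasurableSet {a | (h'.2, a) ∈ S} := measurable_prodMk_left hS
    have : ∫⁻ a, Sᶜ.indicator 1 (h'.2, a) ∂(π.rule n h') =
        ∫⁻ a, {a | (h'.2, a) ∈ S}ᶜ.indicator 1 a ∂(π.rule n h') := rfl
    rw [this, lintegral_indicator_one hm.compl]
    exact (prob_compl_eq_zero_iff hm).2 (h h')
  have hmeas : Measurable (Sᶜ.indicator (1 : X × A → ENNReal)) :=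
    measurable_one.indicator hS.compl
  have hint : ∫⁻ ω, Sᶜ.indicator (1 : X × A → ENNReal) (ω n) ∂(law π x) = 0 := by
    cases n with
    | zero => rw [lintegral_law_zero π x hmeas]; exact hzero _
    | succ n =>
      rw [lintegral_law_succ π x n hmeas]
      have : ∀ ω : ℕ → X × A, ∫⁻ y, ∫⁻ a, Sᶜ.indicator (1 : X × A → ENNReal) (y, a)
        ∂(π.rule (n + 1) (nextHistory n (Preorder.frestrictLe (π := fun _ => X × A) n ω, y)))
          ∂(M.transKernel (ω n)) = 0 := fun ω => by
        refine (lintegral_congr fun y => ?_).trans lintegral_zero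
        exact hzero (nextHistory n (Preorder.frestrictLe (π := fun _ => X × A) n ω, y))
      simp_rw [this, lintegral_zero]
  filter_upwards [(lintegral_eq_zero_iff (hmeas.comp (measurable_pi_apply n))).1 hint] with ω hω
  by_contra hn
  simp [hn] at hω

theorem ae_law_mem_graph (π : M.Policy) (x : X) (n : ℕ) :
    ∀ᵐ ω ∂(law π x), ω n ∈ setGraph M.act :=
  ae_law_mem π x n M.graph_measurable fun h => π.rule_act n h

theorem ae_law_markovPolicy [MeasurableEq A] (φ : ℕ → M.Selector) (x : X) (n : ℕ) :
    ∀ᵐ ω ∂(law (M.markovPolicy φ) x), (ω n).2 = (φ n).1 (ω n).1 := by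
  have hS : MeasurableSet {p : X × A | p.2 = (φ n).1 p.1} :=
    measurableSet_eq_fun measurable_snd ((φ n).2.1.comp measurable_fst)
  refine ae_law_mem _ x n hS fun h => ?_
  change Kernel.deterministic (fun h : History X A n => (φ n).1 h.2)
    ((φ n).2.1.comp measurable_snd) h _ = 1
  rw [Kernel.deterministic_apply]
  exact (Measure.dirac_apply' _ (measurable_prodMk_left hS)).trans (Set.indicator_of_mem rfl _)

theorem transKernel_apply_of_mem {p : X × A} (hp : p ∈ setGraph M.act) :
    M.transKernel p = M.q p := by
  classical
  exact if_pos hp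

end MDP

/-! ### Dynamic programming for nonnegative costs -/

namespace MDP

variable {X A : Type*} [MeasurableSpace X] [MeasurableSpace A]

section Definitions

variable (M : MDP X A) (c : X × A → ENNReal) (β : ENNReal)

/-- The one-step cost plus the discounted expected terminal cost `u`. -/
def oneStep (u : X → ENNReal) (p : X × A) : ENNReal :=
  c p + β * ∫⁻ y, u y ∂(M.transKernel p)

/-- Value iteration started at zero. -/
def iterValue : ℕ → X → ENNReal
  | 0 => fun _ => 0
  | n + 1 => fun x => ⨅ a ∈ M.act x, M.oneStep c β (iterValue n) (x, a)

/-- The limit of value iteration. -/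
def limValue (x : X) : ENNReal := ⨆ n, M.iterValue c β n x

end Definitions

variable {M : MDP X A} {c : X × A → ENNReal} {β : ENNReal}

/-- The total discounted cost of a policy over the horizon `N`, for a nonnegative cost function. -/
def totalCost (c : X × A → ENNReal) (β : ENNReal) (N : ℕ) (π : M.Policy) (x : X) : ENNReal :=
  ∑ n ∈ Finset.range N, β ^ n * ∫⁻ ω, c (ω n) ∂(law π x)

/-- The total discounted cost of a policy over the infinite horizon, for a nonnegative cost
function. -/
def totalCostInf (c : X × A → ENNReal) (β : ENNReal) (π : M.Policy) (x : X) : ENNReal :=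
  ∑' n, β ^ n * ∫⁻ ω, c (ω n) ∂(law π x)

theorem oneStep_mono {u w : X → ENNReal} (h : u ≤ w) (p : X × A) :
    M.oneStep c β u p ≤ M.oneStep c β w p := by
  unfold oneStep
  gcongr
  exact h _

theorem monotone_iterValue : Monotone (M.iterValue c β) := by
  refine monotone_nat_of_le_succ fun n => ?_
  induction n with
  | zero => exact fun x => zero_le
  | succ n ih => exact fun x => iInf₂_mono fun a _ => oneStep_mono ih _

theorem iterValue_le_limValue (n : ℕ) : M.iterValue c β n ≤ M.limValue c β :=
  fun x => le_iSup (fun n => M.iterValue c β n x) n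

theorem measurable_oneStep (hc : Measurable c) {u : X → ENNReal} (hu : Measurable u) :
    Measurable (M.oneStep c β u) :=
  hc.add (hu.lintegral_kernel.const_mul β)

/-- Integrating the one-step cost along the trajectory. -/
theorem lintegral_law_oneStep (hc : Measurable c) (π : M.Policy) (x : X) (n : ℕ)
    {u : X → ENNReal} (hu : Measurable u) :
    ∫⁻ ω, M.oneStep c β u (ω n) ∂(law π x) =
      ∫⁻ ω, c (ω n) ∂(law π x) + β * ∫⁻ ω, u (ω (n + 1)).1 ∂(law π x) := by
  unfold oneStep
  have hcn : Measurable fun ω : ℕ → X × A => c (ω n) := hc.comp (measurable_pi_apply n)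
  have hun : Measurable fun ω : ℕ → X × A => ∫⁻ y, u y ∂(M.transKernel (ω n)) :=
    hu.lintegral_kernel.comp (measurable_pi_apply n)
  rw [lintegral_add_left hcn, lintegral_const_mul _ hun,
    lintegral_law_succ_fst π x n hu]

/-- Splitting off the first stage moves the starting time from `j` to `j + 1`, which is why
inductions on the horizon below run over all starting times. -/
theorem sum_range_succ_discounted (e : ℕ → ENNReal) (N j : ℕ) :
    ∑ n ∈ Finset.range (N + 1), β ^ n * e (j + n) =
      e j + β * ∑ n ∈ Finset.range N, β ^ n * e (j + 1 + n) := by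
  rw [Finset.sum_range_succ', Finset.mul_sum, add_comm]
  simp only [pow_zero, one_mul, add_zero]
  congr 1
  refine Finset.sum_congr rfl fun n _ => ?_
  rw [pow_succ, mul_comm (β ^ n) β, mul_assoc, show j + (n + 1) = j + 1 + n by ring]

theorem totalCost_le_totalCostInf (N : ℕ) (π : M.Policy) (x : X) :
    totalCost c β N π x ≤ totalCostInf c β π x :=
  ENNReal.sum_le_tsum _

theorem totalCost_mono (π : M.Policy) (x : X) : Monotone fun N => totalCost c β N π x :=
  fun _ _ h => Finset.sum_le_sum_of_subset (Finset.range_mono h)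

/-! ### Comparison of value iteration with the costs of policies. -/

section LowerBound

variable (hc : Measurable c) (hm : ∀ n, Measurable (M.iterValue c β n))

include hc hm in
theorem lintegral_iterValue_le (π : M.Policy) (x : X) (N j : ℕ) :
    ∫⁻ ω, M.iterValue c β N (ω j).1 ∂(law π x) ≤
      ∑ n ∈ Finset.range N, β ^ n * ∫⁻ ω, c (ω (j + n)) ∂(law π x) := by
  induction N generalizing j with
  | zero => simp [iterValue]
  | succ N ih =>
    rw [sum_range_succ_discounted (fun n => ∫⁻ ω, c (ω n) ∂(law π x))]
    calc ∫⁻ ω, M.iterValue c β (N + 1) (ω j).1 ∂(law π x)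
        -- Almost surely the action taken is available, hence it competes in the infimum.
        ≤ ∫⁻ ω, M.oneStep c β (M.iterValue c β N) (ω j) ∂(law π x) := by
          refine lintegral_mono_ae ?_
          filter_upwards [ae_law_mem_graph π x j] with ω hω
          exact iInf₂_le (ω j).2 hω
      _ = _ := lintegral_law_oneStep hc π x j (hm N)
      _ ≤ _ := by gcongr; exact ih (j + 1)

include hc hm in
theorem iterValue_le_totalCost (π : M.Policy) (x : X) (N : ℕ) :
    M.iterValue c β N x ≤ totalCost c β N π x := by
  have := lintegral_iterValue_le hc hm π x N 0
  rw [lintegral_law_zero_fst π x (hm N)] at this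
  simpa [totalCost] using this

include hc hm in
theorem limValue_le_totalCostInf (π : M.Policy) (x : X) :
    M.limValue c β x ≤ totalCostInf c β π x :=
  iSup_le fun N => (iterValue_le_totalCost hc hm π x N).trans (totalCost_le_totalCostInf N π x)

include hc hm in
-- The first action is exactly `φ x`, and the cost of the next `N` stages is bounded below by the
-- iterate. In the limit this forces optimal stationary policies to use minimizers.
theorem oneStep_iterValue_le_totalCostInf (φ : M.Selector) (x : X) (N : ℕ) :
    M.oneStep c β (M.iterValue c β N) (x, φ.1 x) ≤
      totalCostInf c β (M.stationaryPolicy φ) x := by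
  refine le_trans ?_ (totalCost_le_totalCostInf (N + 1) _ x)
  have hsum := sum_range_succ_discounted (β := β)
    (fun n => ∫⁻ ω, c (ω n) ∂(law (M.stationaryPolicy φ) x)) N 0
  simp only [zero_add] at hsum
  rw [totalCost, hsum]
  refine le_trans (le_of_eq ?_) (add_le_add le_rfl (mul_le_mul_right
    (lintegral_iterValue_le hc hm (M.stationaryPolicy φ) x N 1) β))
  rw [← lintegral_law_oneStep hc _ x 0 (hm N),
    lintegral_law_zero _ x (measurable_oneStep hc (hm N))]
  change _ = ∫⁻ a, M.oneStep c β (M.iterValue c β N) (x, a)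
    ∂(Kernel.deterministic (fun h : History X A 0 => φ.1 h.2) (φ.2.1.comp measurable_snd) _)
  rw [Kernel.deterministic_apply]
  exact (lintegral_dirac' _ ((measurable_oneStep hc (hm N)).comp measurable_prodMk_left)).symm

theorem oneStep_limValue (hm : ∀ n, Measurable (M.iterValue c β n)) (p : X × A) :
    M.oneStep c β (M.limValue c β) p = ⨆ N, M.oneStep c β (M.iterValue c β N) p := by
  unfold oneStep limValue
  rw [lintegral_iSup hm monotone_iterValue, ENNReal.mul_iSup, ENNReal.add_iSup]

include hc hm in
theorem oneStep_limValue_le_totalCostInf (φ : M.Selector) (x : X) :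
    M.oneStep c β (M.limValue c β) (x, φ.1 x) ≤
      totalCostInf c β (M.stationaryPolicy φ) x := by
  rw [oneStep_limValue hm]
  exact iSup_le fun N => oneStep_iterValue_le_totalCostInf hc hm φ x N

include hc hm in
theorem totalCost_markovPolicy [MeasurableEq A] (φ : ℕ → M.Selector) (N : ℕ)
    (hφ : ∀ n < N, ∀ x, M.oneStep c β (M.iterValue c β n) (x, (φ (N - 1 - n)).1 x) =
      M.iterValue c β (n + 1) x) (x : X) :
    totalCost c β N (M.markovPolicy φ) x = M.iterValue c β N x := by
  -- At time `j` exactly `m = N - j` stages remain, so the selector in force minimizes with respect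
  -- to the iterate `m - 1` when `m` is positive.
  have key : ∀ m j, j + m = N →
      ∫⁻ ω, M.iterValue c β m (ω j).1 ∂(law (M.markovPolicy φ) x) =
        ∑ n ∈ Finset.range m, β ^ n * ∫⁻ ω, c (ω (j + n)) ∂(law (M.markovPolicy φ) x) := by
    intro m
    induction m with
    | zero => intro j _; simp [iterValue]
    | succ m ih =>
      intro j hj
      rw [sum_range_succ_discounted (fun n => ∫⁻ ω, c (ω n) ∂(law (M.markovPolicy φ) x)),
        ← ih (j + 1) (by omega), ← lintegral_law_oneStep hc _ x j (hm m)]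
      refine lintegral_congr_ae ?_
      filter_upwards [ae_law_markovPolicy φ x j] with ω hω
      rw [← hφ m (by omega), show N - 1 - m = j by omega, ← hω]
  have := key N 0 (by omega)
  rw [lintegral_law_zero_fst _ x (hm N)] at this
  simpa [totalCost] using this.symm

include hc in
-- Iterating the fixed-point equation writes `w` as a finite-horizon cost plus a nonnegative
-- terminal term; the term is dropped before the horizon goes to infinity.
theorem totalCostInf_stationaryPolicy_le [MeasurableEq A] (φ : M.Selector) {w : X → ENNReal}
    (hw : Measurable w) (hφ : ∀ x, M.oneStep c β w (x, φ.1 x) = w x) (x : X) :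
    totalCostInf c β (M.stationaryPolicy φ) x ≤ w x := by
  have key : ∀ m j,
      ∑ n ∈ Finset.range m, β ^ n * ∫⁻ ω, c (ω (j + n)) ∂(law (M.stationaryPolicy φ) x) ≤
        ∫⁻ ω, w (ω j).1 ∂(law (M.stationaryPolicy φ) x) := by
    intro m
    induction m with
    | zero => simp
    | succ m ih =>
      intro j
      rw [sum_range_succ_discounted (fun n => ∫⁻ ω, c (ω n) ∂(law (M.stationaryPolicy φ) x))]
      calc _ ≤ ∫⁻ ω, c (ω j) ∂(law (M.stationaryPolicy φ) x) +
            β * ∫⁻ ω, w (ω (j + 1)).1 ∂(law (M.stationaryPolicy φ) x) := by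
            gcongr; exact ih (j + 1)
        _ = ∫⁻ ω, M.oneStep c β w (ω j) ∂(law (M.stationaryPolicy φ) x) :=
            (lintegral_law_oneStep hc _ x j hw).symm
        _ = _ := by
            refine lintegral_congr_ae ?_
            filter_upwards [ae_law_markovPolicy (fun _ => φ) x j] with ω hω
            rw [← hφ, ← hω]
  rw [totalCostInf, ENNReal.tsum_eq_iSup_nat]
  refine iSup_le fun m => ?_
  have := key m 0
  rw [lintegral_law_zero_fst _ x hw] at this
  simpa using this

end LowerBound

/-! ### Optimality equation and optimal policies for nonnegative costs. -/

section Topology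

variable [TopologicalSpace X] [TopologicalSpace A] [TopologicalSpace.PseudoMetrizableSpace X]
  [BorelSpace X] [FirstCountableTopology A]

theorem WeaklyContinuous.lowerSemicontinuousOn_lintegral (hq : M.WeaklyContinuous)
    {u : X → ENNReal} (hu : LowerSemicontinuous u) :
    LowerSemicontinuousOn (fun p => ∫⁻ y, u y ∂(M.transKernel p)) (setGraph M.act) := by
  let μ : setGraph M.act → ProbabilityMeasure X := fun p => ⟨M.q p, M.q_prob p p.2⟩
  have hμ : Continuous μ := by
    rw [continuous_iff_continuousAt]
    intro p
    refine ProbabilityMeasure.tendsto_iff_forall_integral_tendsto.2 fun f => ?_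
    exact (continuousOn_iff_continuous_domRestrict.1 (hq f)).continuousAt
  rw [← lowerSemicontinuous_restrict_iff]
  convert lowerSemicontinuous_lintegral_of_continuous hμ hu using 2 with p
  simp only [Set.domRestrict_apply]
  rw [transKernel_apply_of_mem p.2]
  rfl

variable (hK : KInfCompact M.act c) (hq : M.WeaklyContinuous) (hβ : β ≠ ⊤)

include hK hq hβ

theorem kInfCompact_oneStep {u : X → ENNReal} (hu : LowerSemicontinuous u) :
    KInfCompact M.act (M.oneStep c β u) := by
  refine hK.of_le ?_ fun p _ => le_self_add
  exact hK.lsc.add ((ENNReal.continuous_const_mul hβ).comp_lowerSemicontinuousOn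
    (hq.lowerSemicontinuousOn_lintegral hu) fun _ _ h => mul_le_mul_right h β)

theorem lowerSemicontinuous_iterValue (n : ℕ) : LowerSemicontinuous (M.iterValue c β n) := by
  induction n with
  | zero => exact lowerSemicontinuous_const
  | succ n ih => exact (kInfCompact_oneStep hK hq hβ ih).lowerSemicontinuous_iInf

theorem lowerSemicontinuous_limValue : LowerSemicontinuous (M.limValue c β) :=
  lowerSemicontinuous_iSup fun n => lowerSemicontinuous_iterValue hK hq hβ n

theorem measurable_iterValue (n : ℕ) : Measurable (M.iterValue c β n) :=
  (lowerSemicontinuous_iterValue hK hq hβ n).measurable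

/-- The optimality equation for the limit of value iteration. -/
theorem limValue_eq_iInf (x : X) :
    M.limValue c β x = ⨅ a ∈ M.act x, M.oneStep c β (M.limValue c β) (x, a) := by
  have hlsc := lowerSemicontinuous_iterValue hK hq hβ
  refine le_antisymm (iSup_le fun n => ?_) ?_
  · cases n with
    | zero => exact zero_le
    | succ n => exact iInf₂_mono fun a _ => oneStep_mono (iterValue_le_limValue n) _
  · by_cases htop : M.limValue c β x = ⊤
    · rw [htop]; exact le_top
    -- `a n` minimizes the one-step cost with terminal cost the `n`-th iterate; its own cost stays
    -- below the finite limit value, so the sequence accumulates.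
    choose a ha hmin using fun n =>
      (kInfCompact_oneStep hK hq hβ (hlsc n)).exists_isMinOn (M.act_nonempty x)
    have hle : ∀ n, M.oneStep c β (M.iterValue c β n) (x, a n) ≤ M.limValue c β x := fun n =>
      (le_iInf₂ (hmin n) : _ ≤ M.iterValue c β (n + 1) x).trans (iterValue_le_limValue (n + 1) x)
    obtain ⟨a', ha', hcl⟩ := hK.limitPoint (fun _ => x) x tendsto_const_nhds a ha _ htop
      fun n => le_self_add.trans (hle n)
    refine (iInf₂_le a' ha').trans ?_
    rw [oneStep_limValue (fun n => (hlsc n).measurable)]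
    -- With `m` fixed, monotonicity bounds the `m`-th one-step cost at `a n` for all `n ≥ m`; lower
    -- semicontinuity passes the bound to `a'`.
    refine iSup_le fun m => ?_
    refine KInfCompact.le_of_mapClusterPt (kInfCompact_oneStep hK hq hβ (hlsc m)).lsc
      tendsto_const_nhds ha ha' hcl ?_
    filter_upwards [eventually_ge_atTop m] with n hn
    exact (oneStep_mono (monotone_iterValue hn) _).trans (hle n)

variable [TopologicalSpace.MetrizableSpace A] [SecondCountableTopology A] [BorelSpace A]

theorem exists_selector_argmin {u : X → ENNReal} (hu : LowerSemicontinuous u) :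
    ∃ φ : M.Selector, ∀ x,
      M.oneStep c β u (x, φ.1 x) = ⨅ a ∈ M.act x, M.oneStep c β u (x, a) := by
  obtain ⟨φ, hφ, h⟩ :=
    (kInfCompact_oneStep hK hq hβ hu).exists_measurable_argmin M.exists_selector
  exact ⟨⟨φ, hφ, fun x => (h x).1⟩, fun x => (h x).2⟩

theorem exists_markovPolicy_totalCost (hc : Measurable c) (N : ℕ) :
    ∃ φ : ℕ → M.Selector, ∀ x,
      totalCost c β N (M.markovPolicy φ) x = M.iterValue c β N x := by
  choose φ hφ using fun n =>
    exists_selector_argmin hK hq hβ (lowerSemicontinuous_iterValue hK hq hβ n)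
  refine ⟨fun k => φ (N - 1 - k), totalCost_markovPolicy hc (measurable_iterValue hK hq hβ) _ N
    fun n hn x => ?_⟩
  rw [show N - 1 - (N - 1 - n) = n by omega]
  exact hφ n x

theorem totalCostInf_stationaryPolicy_eq (hc : Measurable c) (φ : M.Selector)
    (hφ : ∀ x, M.oneStep c β (M.limValue c β) (x, φ.1 x) = M.limValue c β x) (x : X) :
    totalCostInf c β (M.stationaryPolicy φ) x = M.limValue c β x :=
  le_antisymm (totalCostInf_stationaryPolicy_le hc φ
    (lowerSemicontinuous_limValue hK hq hβ).measurable hφ x)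
    (limValue_le_totalCostInf hc (measurable_iterValue hK hq hβ) _ x)

theorem exists_stationaryPolicy_totalCostInf (hc : Measurable c) :
    ∃ φ : M.Selector, ∀ x,
      totalCostInf c β (M.stationaryPolicy φ) x = M.limValue c β x := by
  obtain ⟨φ, hφ⟩ := exists_selector_argmin hK hq hβ (lowerSemicontinuous_limValue hK hq hβ)
  exact ⟨φ, totalCostInf_stationaryPolicy_eq hK hq hβ hc φ fun x =>
    (hφ x).trans (limValue_eq_iInf hK hq hβ x).symm⟩

theorem iInf_totalCost (hc : Measurable c) (N : ℕ) (x : X) :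
    ⨅ π : M.Policy, totalCost c β N π x = M.iterValue c β N x := by
  obtain ⟨φ, hφ⟩ := exists_markovPolicy_totalCost hK hq hβ hc N
  exact le_antisymm ((iInf_le _ (M.markovPolicy φ)).trans (hφ x).le)
    (le_iInf fun π => iterValue_le_totalCost hc (measurable_iterValue hK hq hβ) π x N)

theorem iInf_totalCostInf (hc : Measurable c) (x : X) :
    ⨅ π : M.Policy, totalCostInf c β π x = M.limValue c β x := by
  obtain ⟨φ, hφ⟩ := exists_stationaryPolicy_totalCostInf hK hq hβ hc
  exact le_antisymm ((iInf_le _ (M.stationaryPolicy φ)).trans (hφ x).le)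
    (le_iInf fun π => limValue_le_totalCostInf hc (measurable_iterValue hK hq hβ) π x)

end Topology

end MDP

/-! ### Extended-real-valued functions that are bounded below -/

/-- The embedding of `[0, ∞]` into the extended reals followed by a translation. -/
def shiftEReal (r : ℝ) (t : ENNReal) : EReal := (t : EReal) + (r : EReal)

theorem strictMono_shiftEReal (r : ℝ) : StrictMono (shiftEReal r) := fun _ _ h =>
  EReal.add_lt_add_right_coe (EReal.coe_ennreal_strictMono h) r

theorem tendsto_shiftEReal {ι : Type*} {l : Filter ι} {t : ι → ENNReal} {t' : ENNReal} {r : ι → ℝ}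
    {r' : ℝ} (ht : Tendsto t l (𝓝 t')) (hr : Tendsto r l (𝓝 r')) :
    Tendsto (fun i => shiftEReal (r i) (t i)) l (𝓝 (shiftEReal r' t')) := by
  have h : ContinuousAt (fun p : EReal × EReal => p.1 + p.2) ((t' : EReal), (r' : EReal)) :=
    EReal.continuousAt_add (Or.inr (EReal.coe_ne_bot _)) (Or.inr (EReal.coe_ne_top _))
  exact h.tendsto.comp ((EReal.tendsto_coe_ennreal.2 ht).prodMk_nhds (EReal.tendsto_coe.2 hr))

theorem continuous_shiftEReal (r : ℝ) : Continuous (shiftEReal r) :=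
  continuous_iff_continuousAt.2 fun _ => tendsto_shiftEReal tendsto_id tendsto_const_nhds

theorem shiftEReal_top (r : ℝ) : shiftEReal r ⊤ = ⊤ := by
  simp [shiftEReal]

theorem shiftEReal_add (r s : ℝ) (t u : ENNReal) :
    shiftEReal (r + s) (t + u) = shiftEReal r t + shiftEReal s u := by
  simp only [shiftEReal, EReal.coe_ennreal_add, EReal.coe_add]
  exact add_add_add_comm _ _ _ _

theorem coe_mul_shiftEReal {α : ℝ} (hα : 0 ≤ α) (r : ℝ) (t : ENNReal) :
    (α : EReal) * shiftEReal r t = shiftEReal (α * r) (ENNReal.ofReal α * t) := by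
  rw [shiftEReal, EReal.left_distrib_of_nonneg_of_ne_top (by exact_mod_cast hα)
    (EReal.coe_ne_top _), shiftEReal, EReal.coe_ennreal_mul, EReal.coe_ennreal_ofReal,
    max_eq_left hα, EReal.coe_mul]

theorem sum_shiftEReal {ι : Type*} (s : Finset ι) (r : ι → ℝ) (t : ι → ENNReal) :
    ∑ i ∈ s, shiftEReal (r i) (t i) = shiftEReal (∑ i ∈ s, r i) (∑ i ∈ s, t i) := by
  classical
  induction s using Finset.induction_on with
  | empty => simp [shiftEReal]
  | insert i s hi ih =>
    rw [Finset.sum_insert hi, Finset.sum_insert hi, Finset.sum_insert hi, ih, shiftEReal_add]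

theorem tsum_shiftEReal {ι : Type*} {r : ι → ℝ} {r' : ℝ} (hr : HasSum r r') (t : ι → ENNReal) :
    ∑' i, shiftEReal (r i) (t i) = shiftEReal r' (∑' i, t i) := by
  refine HasSum.tsum_eq ?_
  have := tendsto_shiftEReal (ENNReal.summable (f := t)).hasSum hr
  simp only [HasSum, sum_shiftEReal]
  exact this

/-- This is `f⁺ - f⁻ = t + r⁺ - r⁻` rearranged without subtraction, so that it can be integrated in
`[0, ∞]`. -/
theorem toENNReal_shiftEReal_add (r : ℝ) (t : ENNReal) :
    (shiftEReal r t).toENNReal + ENNReal.ofReal (-r) =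
      t + ENNReal.ofReal r + (-shiftEReal r t).toENNReal := by
  induction t with
  | top => simp [shiftEReal_top]
  | coe s =>
    have h : shiftEReal r s = ((s + r : ℝ) : EReal) := rfl
    rw [h, ← EReal.coe_neg, EReal.real_coe_toENNReal, EReal.real_coe_toENNReal]
    simp only [ENNReal.ofReal]
    norm_cast
    apply NNReal.eq
    have hs : (0 : ℝ) ≤ s := s.2
    simp only [NNReal.coe_add, Real.coe_toNNReal']
    rcases max_cases ((s : ℝ) + r) 0 with h1 | h1 <;> rcases max_cases (-r) 0 with h2 | h2 <;>
      rcases max_cases r 0 with h3 | h3 <;> rcases max_cases (-((s : ℝ) + r)) 0 with h4 | h4 <;>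
      linarith

theorem toENNReal_neg_shiftEReal_le (r : ℝ) (t : ENNReal) :
    (-shiftEReal r t).toENNReal ≤ ENNReal.ofReal (-r) := by
  rw [← EReal.real_coe_toENNReal]
  refine EReal.toENNReal_le_toENNReal ?_
  rw [EReal.coe_neg, EReal.neg_le_neg_iff]
  have h : (0 : EReal) + r ≤ t + r := add_le_add_left (EReal.coe_ennreal_nonneg t) _
  rwa [zero_add] at h

theorem coe_sub_coe_eq_shiftEReal {P N G : ENNReal} {r : ℝ} (hN : N ≠ ⊤)
    (h : P + ENNReal.ofReal (-r) = G + ENNReal.ofReal r + N) :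
    (P : EReal) - (N : EReal) = shiftEReal r G := by
  lift N to NNReal using hN
  induction G with
  | top =>
    have : P = ⊤ := by simpa using h
    rw [this, shiftEReal_top]
    exact EReal.top_sub_coe N
  | coe G =>
    have hP : P ≠ ⊤ := by
      rintro rfl
      simp [ENNReal.ofReal] at h
      exact absurd h.symm (by finiteness)
    lift P to NNReal using hP
    have hs : ((P : ℝ) : EReal) - ((N : ℝ) : EReal) = ((G : ℝ) : EReal) + (r : EReal) := by
      simp only [ENNReal.ofReal] at h
      norm_cast at h ⊢
      have h' := congrArg NNReal.toReal h
      simp only [NNReal.coe_add, Real.coe_toNNReal'] at h'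
      have : max r 0 - max (-r) 0 = r := max_zero_sub_max_neg_zero_eq_self r
      linarith
    exact hs

/-- Total mass one preserves the constant `r`, and the negative part is at most `r⁻`, so the final
subtraction is legitimate. -/
theorem erealIntegral_eq_shiftEReal {Ω : Type*} [MeasurableSpace Ω] (μ : Measure Ω)
    [IsProbabilityMeasure μ] {f : Ω → EReal} {g : Ω → ENNReal} {r : ℝ} (hg : Measurable g)
    (hf : ∀ᵐ ω ∂μ, f ω = shiftEReal r (g ω)) :
    erealIntegral μ f = shiftEReal r (∫⁻ ω, g ω ∂μ) := by
  have hshift : Measurable fun ω => shiftEReal r (g ω) :=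
    (continuous_shiftEReal r).measurable.comp hg
  have h1 : ∫⁻ ω, (f ω).toENNReal ∂μ = ∫⁻ ω, (shiftEReal r (g ω)).toENNReal ∂μ :=
    lintegral_congr_ae (hf.mono fun ω h => by simp only [h])
  have h2 : ∫⁻ ω, (-f ω).toENNReal ∂μ = ∫⁻ ω, (-shiftEReal r (g ω)).toENNReal ∂μ :=
    lintegral_congr_ae (hf.mono fun ω h => by simp only [h])
  rw [erealIntegral, h1, h2]
  refine coe_sub_coe_eq_shiftEReal ?_ ?_
  · refine ne_top_of_le_ne_top (ENNReal.ofReal_ne_top (r := -r))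
      ((lintegral_mono fun ω => toENNReal_neg_shiftEReal_le r (g ω)).trans ?_)
    simp
  · have h := lintegral_congr (μ := μ) fun ω => toENNReal_shiftEReal_add r (g ω)
    rw [lintegral_add_left hshift.ereal_toENNReal, lintegral_add_left (hg.add_const _),
      lintegral_add_left hg] at h
    simpa using h

/-! ### Reduction to nonnegative costs -/

namespace MDP

variable {X A : Type*} [MeasurableSpace X] [MeasurableSpace A] (M : MDP X A)

/-- The excess of the cost over the lower bound `K`, set to zero outside the graph of the action
sets. -/
def excessCost (K : ℝ) : X × A → ENNReal :=
  (setGraph M.act).indicator fun p => (M.cost p - (K : EReal)).toENNReal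

variable {M} {K : ℝ}

theorem measurable_excessCost : Measurable (M.excessCost K) := by
  refine measurable_of_restrict_of_restrict_compl M.graph_measurable ?_ ?_
  · have h : Measurable fun p : setGraph M.act => (M.cost p - (K : EReal)).toENNReal :=
      (M.cost_measurable.sub_const _).ereal_toENNReal
    convert h using 1
    funext p
    simp only [Set.domRestrict_apply, excessCost]
    exact Set.indicator_of_mem p.2 _
  · convert (measurable_const (a := (0 : ENNReal))) using 1
    funext p
    simp only [Set.domRestrict_apply, excessCost]
    exact Set.indicator_of_notMem p.2 _

variable (hK : ∀ p ∈ setGraph M.act, (K : EReal) ≤ M.cost p)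

include hK in
theorem cost_eq_shiftEReal {p : X × A} (hp : p ∈ setGraph M.act) :
    M.cost p = shiftEReal K (M.excessCost K p) := by
  have h0 : 0 ≤ M.cost p - (K : EReal) :=
    (EReal.sub_nonneg (Or.inr (EReal.coe_ne_top _)) (Or.inr (EReal.coe_ne_bot _))).2 (hK p hp)
  rw [shiftEReal, excessCost, Set.indicator_of_mem hp, EReal.coe_toENNReal h0,
    EReal.sub_add_cancel]

variable {α : ℝ} (hα : 0 ≤ α)

include hK hα in
theorem discounted_cost_eq {p : X × A} (hp : p ∈ setGraph M.act) (n : ℕ) :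
    ((α ^ n : ℝ) : EReal) * M.cost p =
      shiftEReal (α ^ n * K) (ENNReal.ofReal α ^ n * M.excessCost K p) := by
  rw [cost_eq_shiftEReal hK hp, coe_mul_shiftEReal (by positivity), ENNReal.ofReal_pow hα]

include hK hα in
theorem costN_eq (N : ℕ) (π : M.Policy) (x : X) :
    costN α N π x = shiftEReal (K * ∑ i ∈ Finset.range N, α ^ i)
      (totalCost (M.excessCost K) (ENNReal.ofReal α) N π x) := by
  have hm : ∀ n, Measurable fun ω : ℕ → X × A => ENNReal.ofReal α ^ n * M.excessCost K (ω n) :=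
    fun n => (measurable_excessCost.comp (measurable_pi_apply n)).const_mul _
  have hsum : totalCost (M.excessCost K) (ENNReal.ofReal α) N π x =
      ∫⁻ ω, ∑ n ∈ Finset.range N, ENNReal.ofReal α ^ n * M.excessCost K (ω n) ∂(law π x) := by
    rw [lintegral_finsetSum _ fun n _ => hm n]
    refine Finset.sum_congr rfl fun n _ => (lintegral_const_mul _ ?_).symm
    exact measurable_excessCost.comp (measurable_pi_apply n)
  rw [hsum]
  refine erealIntegral_eq_shiftEReal _ (Finset.measurable_fun_sum _ fun n _ => hm n) ?_
  filter_upwards [ae_all_iff.2 fun n => ae_law_mem_graph π x n] with ω hω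
  rw [Finset.sum_congr rfl fun n _ => discounted_cost_eq hK hα (hω n) n, sum_shiftEReal,
    Finset.mul_sum]
  simp_rw [mul_comm K]

include hK hα in
theorem costInf_eq (hα1 : α < 1) (π : M.Policy) (x : X) :
    costInf α π x = shiftEReal (K * (1 - α)⁻¹)
      (totalCostInf (M.excessCost K) (ENNReal.ofReal α) π x) := by
  have hm : ∀ n, Measurable fun ω : ℕ → X × A => ENNReal.ofReal α ^ n * M.excessCost K (ω n) :=
    fun n => (measurable_excessCost.comp (measurable_pi_apply n)).const_mul _
  have hsum : totalCostInf (M.excessCost K) (ENNReal.ofReal α) π x =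
      ∫⁻ ω, ∑' n, ENNReal.ofReal α ^ n * M.excessCost K (ω n) ∂(law π x) := by
    rw [lintegral_tsum fun n => (hm n).aemeasurable]
    refine tsum_congr fun n => (lintegral_const_mul _ ?_).symm
    exact measurable_excessCost.comp (measurable_pi_apply n)
  rw [hsum]
  refine erealIntegral_eq_shiftEReal _ (Measurable.tsum hm) ?_
  filter_upwards [ae_all_iff.2 fun n => ae_law_mem_graph π x n] with ω hω
  have hr : HasSum (fun n => α ^ n * K) (K * (1 - α)⁻¹) := by
    rw [mul_comm K]
    exact (hasSum_geometric_of_lt_one hα hα1).mul_right K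
  rw [tsum_congr fun n => discounted_cost_eq hK hα (hω n) n, tsum_shiftEReal hr]

include hK hα in
-- The map `r ↦ K + α * r` sends the shift of horizon `n` to that of horizon `n + 1` and, for `α <
-- 1`, fixes `K * (1 - α)⁻¹`; thus values and `eta` carry equal shifts.
theorem eta_eq {u : X → EReal} {w : X → ENNReal} {r : ℝ} (hw : Measurable w)
    (hu : ∀ x, u x = shiftEReal r (w x)) {x : X} {a : A} (ha : a ∈ M.act x) :
    M.eta α u x a =
      shiftEReal (K + α * r) (M.oneStep (M.excessCost K) (ENNReal.ofReal α) w (x, a)) := by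
  have hp : (x, a) ∈ setGraph M.act := ha
  have := M.q_prob _ hp
  rw [eta, cost_eq_shiftEReal hK hp,
    erealIntegral_eq_shiftEReal _ hw (Eventually.of_forall hu), coe_mul_shiftEReal hα,
    ← shiftEReal_add, oneStep, transKernel_apply_of_mem hp]

section Values

instance nonempty_policy : Nonempty M.Policy := by
  obtain ⟨φ, hφ⟩ := M.exists_selector
  exact ⟨M.stationaryPolicy ⟨φ, hφ⟩⟩

theorem iInf_shiftEReal {ι : Type*} (r : ℝ) (t : ι → ENNReal) :
    ⨅ i, shiftEReal r (t i) = shiftEReal r (⨅ i, t i) :=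
  ((strictMono_shiftEReal r).monotone.map_iInf_of_continuousAt
    (continuous_shiftEReal r).continuousAt (shiftEReal_top r)).symm

include hK hα in
theorem valueN_eq_iInf (N : ℕ) (x : X) :
    M.valueN α N x = shiftEReal (K * ∑ i ∈ Finset.range N, α ^ i)
      (⨅ π : M.Policy, totalCost (M.excessCost K) (ENNReal.ofReal α) N π x) := by
  rw [valueN, ← iInf_shiftEReal]
  exact iInf_congr fun π => costN_eq hK hα N π x

include hK hα in
theorem valueInf_eq_iInf (hα1 : α < 1) (x : X) :
    M.valueInf α x = shiftEReal (K * (1 - α)⁻¹)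
      (⨅ π : M.Policy, totalCostInf (M.excessCost K) (ENNReal.ofReal α) π x) := by
  rw [valueInf, ← iInf_shiftEReal]
  exact iInf_congr fun π => costInf_eq hK hα hα1 π x

include hK hα in
-- Removing the shift leaves an infimum over policies of nonnegative totals, each growing with the
-- horizon.
theorem monotone_valueN_sub (x : X) : Monotone fun n =>
    M.valueN α n x - ((K * ∑ i ∈ Finset.range n, α ^ i : ℝ) : EReal) := by
  have h : ∀ n, M.valueN α n x - ((K * ∑ i ∈ Finset.range n, α ^ i : ℝ) : EReal) =
      ((⨅ π : M.Policy, totalCost (M.excessCost K) (ENNReal.ofReal α) n π x : ENNReal) : EReal) :=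
    fun n => by
      rw [valueN_eq_iInf hK hα, shiftEReal]
      exact EReal.add_sub_cancel_right
  simp only [h]
  exact fun n m hnm =>
    EReal.coe_ennreal_le_coe_ennreal_iff.2 (iInf_mono fun π => totalCost_mono π x hnm)

end Values

/-! ### The two assumptions in terms of the excess cost. -/

section Topology

variable [TopologicalSpace X] [TopologicalSpace A]

include hK in
theorem AssumptionWStar.kInfCompact_excessCost (hW : M.AssumptionWStar) :
    KInfCompact M.act (M.excessCost K) where
  lsc := by
    have hcont : Continuous fun t : EReal => (t - (K : EReal)).toENNReal := by
      refine EReal.continuous_toENNReal.comp (continuous_iff_continuousAt.2 fun t => ?_)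
      have h : ContinuousAt (fun p : EReal × EReal => p.1 + p.2) (t, ((-K : ℝ) : EReal)) :=
        EReal.continuousAt_add (Or.inr (EReal.coe_ne_bot _)) (Or.inr (EReal.coe_ne_top _))
      exact h.tendsto.comp (tendsto_id.prodMk_nhds tendsto_const_nhds)
    have hlsc := hcont.comp_lowerSemicontinuousOn hW.lsc fun s t hst =>
      EReal.toENNReal_le_toENNReal (EReal.sub_le_sub hst le_rfl)
    rw [← lowerSemicontinuous_restrict_iff] at hlsc ⊢
    convert hlsc using 1
    funext p
    simp only [Set.domRestrict_apply, excessCost, Function.comp_apply]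
    rw [Set.indicator_of_mem p.2]
  limitPoint x x' hx a ha L hL hb := by
    refine hW.limitPoint x x' hx a ha ⟨L.toReal + K, fun n => ?_⟩
    rw [cost_eq_shiftEReal hK (ha n), EReal.coe_add, ← ENNReal.ofReal_toReal hL] at *
    refine add_le_add ?_ le_rfl
    have := EReal.coe_ennreal_le_coe_ennreal_iff.2 (hb n)
    rw [EReal.coe_ennreal_ofReal, max_eq_left ENNReal.toReal_nonneg] at this
    simpa using this

/-- Compact sublevel sets are closed, which gives lower semicontinuity. State-action pairs of
bounded cost accumulate in one of them, and uniqueness of limits identifies the state component. -/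
theorem AssumptionWu.assumptionWStar [T2Space X] [T2Space A] (hW : M.AssumptionWu) :
    M.AssumptionWStar where
  lsc := by
    intro p hp y hy
    obtain ⟨l, hyl, hl⟩ := EReal.lt_iff_exists_real_btwn.1 hy
    have hopen : IsOpen {y | y ∈ setGraph M.act ∧ M.cost y ≤ (l : EReal)}ᶜ :=
      (hW.infCompact l).isClosed.isOpen_compl
    have hmem : p ∈ {y | y ∈ setGraph M.act ∧ M.cost y ≤ (l : EReal)}ᶜ :=
      fun h => absurd h.2 (not_le.2 hl)
    filter_upwards [mem_nhdsWithin_of_mem_nhds (hopen.mem_nhds hmem), self_mem_nhdsWithin]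
      with z hz hzG
    exact hyl.trans (not_le.1 fun h => hz ⟨hzG, h⟩)
  limitPoint x x' hx a ha hb := by
    obtain ⟨L, hL⟩ := hb
    obtain ⟨⟨x₁, a₁⟩, hmem, hcl⟩ := (hW.infCompact L).exists_mapClusterPt
      (f := atTop) (u := fun n => (x n, a n))
      (tendsto_principal.2 (Eventually.of_forall fun n => ⟨ha n, hL n⟩))
    have hx₁ : MapClusterPt x₁ atTop x :=
      hcl.continuousAt_comp (f := Prod.fst) continuous_fst.continuousAt
    have ha₁ : MapClusterPt a₁ atTop a :=
      hcl.continuousAt_comp (f := Prod.snd) continuous_snd.continuousAt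
    have : x₁ = x' := by
      have hne : (𝓝 x₁ ⊓ 𝓝 x').NeBot := hx₁.neBot.mono (inf_le_inf_left _ hx)
      exact eq_of_nhds_neBot hne
    subst this
    exact ⟨a₁, hmem.1, ha₁⟩
  weaklyContinuous := hW.weaklyContinuous

/-- Minimization of a shifted inf-compact function over the action sets. -/
theorem isLeast_and_argmin [FirstCountableTopology X] [OpensMeasurableSpace X]
    [TopologicalSpace.PseudoMetrizableSpace A] {f : X × A → ENNReal} (hf : KInfCompact M.act f)
    (hfm : Measurable f) {r : ℝ} {v : X → EReal} {e : X → A → EReal}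
    (hv : ∀ x, v x = shiftEReal r (⨅ a ∈ M.act x, f (x, a)))
    (he : ∀ x, ∀ a ∈ M.act x, e x a = shiftEReal r (f (x, a))) :
    (∀ x, IsLeast (e x '' M.act x) (v x)) ∧
    (∀ x, {a | a ∈ M.act x ∧ v x = e x a}.Nonempty) ∧
    MeasurableSet (setGraph fun x => {a | a ∈ M.act x ∧ v x = e x a}) ∧
    (∀ x, v x = ⊤ → {a | a ∈ M.act x ∧ v x = e x a} = M.act x) ∧
    (∀ x, v x < ⊤ → IsCompact {a | a ∈ M.act x ∧ v x = e x a}) := by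
  have hinj := (strictMono_shiftEReal r).injective
  have hmin : ∀ x, ∃ a ∈ M.act x, v x = e x a := by
    intro x
    obtain ⟨a, ha, hmin⟩ := hf.exists_isMinOn (M.act_nonempty x)
    refine ⟨a, ha, ?_⟩
    rw [hv, he x a ha]
    exact congrArg _ (le_antisymm (iInf₂_le a ha) (le_iInf₂ hmin))
  have hle : ∀ x, ∀ a ∈ M.act x, v x ≤ e x a := by
    intro x a ha
    rw [hv, he x a ha]
    exact (strictMono_shiftEReal r).monotone (iInf₂_le a ha)
  refine ⟨fun x => ⟨?_, ?_⟩, hmin, ?_, fun x hx => ?_, fun x hx => ?_⟩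
  · obtain ⟨a, ha, h⟩ := hmin x
    exact ⟨a, ha, h.symm⟩
  · rintro _ ⟨a, ha, rfl⟩
    exact hle x a ha
  · have : (setGraph fun x => {a | a ∈ M.act x ∧ v x = e x a}) =
        setGraph M.act ∩ {p | ⨅ a ∈ M.act p.1, f (p.1, a) = f p} := by
      ext ⟨x, a⟩
      refine and_congr_right fun ha => ?_
      rw [hv, he x a ha]
      exact hinj.eq_iff
    rw [this]
    exact M.graph_measurable.inter
      (measurableSet_eq_fun (hf.lowerSemicontinuous_iInf.measurable.comp measurable_fst) hfm)
  · refine Set.Subset.antisymm (fun a ha => ha.1) fun a ha => ⟨ha, ?_⟩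
    exact le_antisymm (hle x a ha) (by rw [hx]; exact le_top)
  · have hne : (⨅ a ∈ M.act x, f (x, a)) ≠ ⊤ := by
      intro htop
      rw [hv, htop, shiftEReal_top] at hx
      exact lt_irrefl _ hx
    convert hf.isCompact_sublevel x hne using 1
    ext a
    refine and_congr_right fun ha => ?_
    rw [hv, he x a ha, hinj.eq_iff]
    exact ⟨fun h => h.ge, fun h => le_antisymm (iInf₂_le a ha) h⟩

include hK in
theorem AssumptionWu.infCompactOn [T2Space X] (hW : M.AssumptionWu) {v : X → EReal}
    (hlsc : LowerSemicontinuous v) {r : ℝ}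
    (hv : ∀ x, ∃ a ∈ M.act x, shiftEReal r (M.excessCost K (x, a)) ≤ v x) :
    InfCompactOn v Set.univ := by
  intro l
  -- Excess plus `r` at most `l` means cost, which is excess plus `K`, at most `l - r + K`.
  refine ((hW.infCompact (l - r + K)).image continuous_fst).of_isClosed_subset ?_ ?_
  · convert hlsc.isClosed_preimage (l : EReal) using 1
    ext x
    simp
  · rintro x ⟨-, hx⟩
    obtain ⟨a, ha, hle⟩ := hv x
    refine ⟨(x, a), ⟨ha, ?_⟩, rfl⟩
    rw [cost_eq_shiftEReal hK ha]
    have h := hle.trans hx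
    generalize M.excessCost K (x, a) = t at h
    induction t with
    | top => rw [shiftEReal_top] at h; exact absurd h (by simp)
    | coe s =>
      have h1 : shiftEReal r s = ((s + r : ℝ) : EReal) := rfl
      have h2 : shiftEReal K s = ((s + K : ℝ) : EReal) := rfl
      rw [h1, EReal.coe_le_coe_iff] at h
      rw [h2, EReal.coe_le_coe_iff]
      linarith

end Topology

end MDP

/-! ### Optimal values and policies -/

namespace MDP

variable {X A : Type*} [MeasurableSpace X] [MeasurableSpace A] {M : MDP X A} {K α : ℝ}
  [TopologicalSpace X] [TopologicalSpace A] [TopologicalSpace.MetrizableSpace X] [BorelSpace X]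
  [TopologicalSpace.MetrizableSpace A] [SecondCountableTopology A] [BorelSpace A]
  (hK : ∀ p ∈ setGraph M.act, (K : EReal) ≤ M.cost p) (hα : 0 ≤ α) (hW : M.AssumptionWStar)

include hK hα hW

theorem valueN_eq (n : ℕ) (x : X) :
    M.valueN α n x = shiftEReal (K * ∑ i ∈ Finset.range n, α ^ i)
      (M.iterValue (M.excessCost K) (ENNReal.ofReal α) n x) := by
  rw [valueN_eq_iInf hK hα, iInf_totalCost (hW.kInfCompact_excessCost hK) hW.weaklyContinuous
    ENNReal.ofReal_ne_top measurable_excessCost]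

theorem valueInf_eq (hα1 : α < 1) (x : X) :
    M.valueInf α x = shiftEReal (K * (1 - α)⁻¹)
      (M.limValue (M.excessCost K) (ENNReal.ofReal α) x) := by
  rw [valueInf_eq_iInf hK hα hα1, iInf_totalCostInf (hW.kInfCompact_excessCost hK)
    hW.weaklyContinuous ENNReal.ofReal_ne_top measurable_excessCost]

theorem lowerSemicontinuous_valueN (n : ℕ) : LowerSemicontinuous (M.valueN α n) := by
  rw [funext (valueN_eq hK hα hW n)]
  exact (continuous_shiftEReal _).comp_lowerSemicontinuous
    (lowerSemicontinuous_iterValue (hW.kInfCompact_excessCost hK) hW.weaklyContinuous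
      ENNReal.ofReal_ne_top n) (strictMono_shiftEReal _).monotone

theorem lowerSemicontinuous_valueInf (hα1 : α < 1) : LowerSemicontinuous (M.valueInf α) := by
  rw [funext (valueInf_eq hK hα hW hα1)]
  exact (continuous_shiftEReal _).comp_lowerSemicontinuous
    (lowerSemicontinuous_limValue (hW.kInfCompact_excessCost hK) hW.weaklyContinuous
      ENNReal.ofReal_ne_top) (strictMono_shiftEReal _).monotone

theorem tendsto_valueN (hα1 : α < 1) (x : X) :
    Tendsto (fun n => M.valueN α n x) atTop (𝓝 (M.valueInf α x)) := by
  simp only [valueN_eq hK hα hW, valueInf_eq hK hα hW hα1]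
  exact tendsto_shiftEReal (tendsto_atTop_iSup fun n m h => monotone_iterValue h x)
    ((hasSum_geometric_of_lt_one hα hα1).tendsto_sum_nat.const_mul K)

theorem eta_valueN_eq (n : ℕ) {x : X} {a : A} (ha : a ∈ M.act x) :
    M.eta α (M.valueN α n) x a = shiftEReal (K * ∑ i ∈ Finset.range (n + 1), α ^ i)
      (M.oneStep (M.excessCost K) (ENNReal.ofReal α)
        (M.iterValue (M.excessCost K) (ENNReal.ofReal α) n) (x, a)) := by
  rw [eta_eq hK hα (measurable_iterValue (hW.kInfCompact_excessCost hK) hW.weaklyContinuous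
    ENNReal.ofReal_ne_top n) (valueN_eq hK hα hW n) ha, geom_sum_succ]
  congr 1
  ring

theorem eta_valueInf_eq (hα1 : α < 1) {x : X} {a : A} (ha : a ∈ M.act x) :
    M.eta α (M.valueInf α) x a = shiftEReal (K * (1 - α)⁻¹)
      (M.oneStep (M.excessCost K) (ENNReal.ofReal α)
        (M.limValue (M.excessCost K) (ENNReal.ofReal α)) (x, a)) := by
  rw [eta_eq hK hα (lowerSemicontinuous_limValue (hW.kInfCompact_excessCost hK)
    hW.weaklyContinuous ENNReal.ofReal_ne_top).measurable (valueInf_eq hK hα hW hα1) ha]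
  congr 1
  have : 1 - α ≠ 0 := by linarith
  field_simp
  ring

theorem mem_argminN_iff (n : ℕ) {x : X} {a : A} (ha : a ∈ M.act x) :
    a ∈ M.argminN α n x ↔ M.oneStep (M.excessCost K) (ENNReal.ofReal α)
        (M.iterValue (M.excessCost K) (ENNReal.ofReal α) n) (x, a) =
      M.iterValue (M.excessCost K) (ENNReal.ofReal α) (n + 1) x := by
  refine (and_iff_right ha).trans ?_
  rw [eta_valueN_eq hK hα hW n ha, valueN_eq hK hα hW,
    (strictMono_shiftEReal _).injective.eq_iff, eq_comm]

theorem mem_argminInf_iff (hα1 : α < 1) {x : X} {a : A} (ha : a ∈ M.act x) :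
    a ∈ M.argminInf α x ↔ M.oneStep (M.excessCost K) (ENNReal.ofReal α)
        (M.limValue (M.excessCost K) (ENNReal.ofReal α)) (x, a) =
      M.limValue (M.excessCost K) (ENNReal.ofReal α) x := by
  refine (and_iff_right ha).trans ?_
  rw [eta_valueInf_eq hK hα hW hα1 ha, valueInf_eq hK hα hW hα1,
    (strictMono_shiftEReal _).injective.eq_iff, eq_comm]

theorem isLeast_valueN_and_argminN (n : ℕ) :
    (∀ x, IsLeast (M.eta α (M.valueN α n) x '' M.act x) (M.valueN α (n + 1) x)) ∧
    (∀ x, (M.argminN α n x).Nonempty) ∧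
    MeasurableSet (setGraph (M.argminN α n)) ∧
    (∀ x, M.valueN α (n + 1) x = ⊤ → M.argminN α n x = M.act x) ∧
    (∀ x, M.valueN α (n + 1) x < ⊤ → IsCompact (M.argminN α n x)) := by
  have hlsc := lowerSemicontinuous_iterValue (hW.kInfCompact_excessCost hK) hW.weaklyContinuous
    (ENNReal.ofReal_ne_top (r := α)) n
  exact isLeast_and_argmin
    (kInfCompact_oneStep (hW.kInfCompact_excessCost hK) hW.weaklyContinuous
      ENNReal.ofReal_ne_top hlsc)
    (measurable_oneStep measurable_excessCost hlsc.measurable)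
    (valueN_eq hK hα hW (n + 1)) fun x a ha => eta_valueN_eq hK hα hW n ha

theorem isLeast_valueInf_and_argminInf (hα1 : α < 1) :
    (∀ x, IsLeast (M.eta α (M.valueInf α) x '' M.act x) (M.valueInf α x)) ∧
    (∀ x, (M.argminInf α x).Nonempty) ∧
    MeasurableSet (setGraph (M.argminInf α)) ∧
    (∀ x, M.valueInf α x = ⊤ → M.argminInf α x = M.act x) ∧
    (∀ x, M.valueInf α x < ⊤ → IsCompact (M.argminInf α x)) := by
  have hlsc := lowerSemicontinuous_limValue (hW.kInfCompact_excessCost hK) hW.weaklyContinuous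
    (ENNReal.ofReal_ne_top (r := α))
  refine isLeast_and_argmin
    (kInfCompact_oneStep (hW.kInfCompact_excessCost hK) hW.weaklyContinuous
      ENNReal.ofReal_ne_top hlsc)
    (measurable_oneStep measurable_excessCost hlsc.measurable)
    (fun x => ?_) fun x a ha => eta_valueInf_eq hK hα hW hα1 ha
  rw [valueInf_eq hK hα hW hα1, ← limValue_eq_iInf (hW.kInfCompact_excessCost hK)
    hW.weaklyContinuous ENNReal.ofReal_ne_top]

theorem exists_isHorizonOptimal_markovPolicy (N : ℕ) :
    ∃ φ : ℕ → M.Selector, IsHorizonOptimal α N (M.markovPolicy φ) := by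
  obtain ⟨φ, hφ⟩ := exists_markovPolicy_totalCost (hW.kInfCompact_excessCost hK)
    hW.weaklyContinuous (ENNReal.ofReal_ne_top (r := α)) measurable_excessCost N
  refine ⟨φ, fun x => ?_⟩
  rw [costN_eq hK hα, valueN_eq hK hα hW, hφ]

theorem isHorizonOptimal_markovPolicy (N : ℕ) (φ : ℕ → M.Selector)
    (hφ : ∀ n < N, ∀ x, (φ (N - 1 - n)).1 x ∈ M.argminN α n x) :
    IsHorizonOptimal α N (M.markovPolicy φ) := by
  intro x
  rw [costN_eq hK hα, valueN_eq hK hα hW, totalCost_markovPolicy measurable_excessCost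
    (measurable_iterValue (hW.kInfCompact_excessCost hK) hW.weaklyContinuous
      ENNReal.ofReal_ne_top) φ N fun n hn x =>
        (mem_argminN_iff hK hα hW n ((φ (N - 1 - n)).2.2 x)).1 (hφ n hn x)]

theorem exists_isDiscountOptimal_stationaryPolicy (hα1 : α < 1) :
    ∃ φ : M.Selector, IsDiscountOptimal α (M.stationaryPolicy φ) := by
  obtain ⟨φ, hφ⟩ := exists_stationaryPolicy_totalCostInf (hW.kInfCompact_excessCost hK)
    hW.weaklyContinuous (ENNReal.ofReal_ne_top (r := α)) measurable_excessCost
  refine ⟨φ, fun x => ?_⟩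
  rw [costInf_eq hK hα hα1, valueInf_eq hK hα hW hα1, hφ]

theorem isDiscountOptimal_stationaryPolicy_iff (hα1 : α < 1) (φ : M.Selector) :
    IsDiscountOptimal α (M.stationaryPolicy φ) ↔ ∀ x, φ.1 x ∈ M.argminInf α x := by
  have hKc := hW.kInfCompact_excessCost hK
  have hβ := ENNReal.ofReal_ne_top (r := α)
  have hopt : ∀ x, costInf α (M.stationaryPolicy φ) x = M.valueInf α x ↔
      totalCostInf (M.excessCost K) (ENNReal.ofReal α) (M.stationaryPolicy φ) x =
        M.limValue (M.excessCost K) (ENNReal.ofReal α) x := fun x => by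
    rw [costInf_eq hK hα hα1, valueInf_eq hK hα hW hα1,
      (strictMono_shiftEReal _).injective.eq_iff]
  constructor
  · intro h x
    rw [mem_argminInf_iff hK hα hW hα1 (φ.2.2 x)]
    refine le_antisymm ?_ ?_
    · rw [← (hopt x).1 (h x)]
      exact oneStep_limValue_le_totalCostInf measurable_excessCost
        (measurable_iterValue hKc hW.weaklyContinuous hβ) φ x
    · rw [limValue_eq_iInf hKc hW.weaklyContinuous hβ]
      exact iInf₂_le (φ.1 x) (φ.2.2 x)
  · intro h x
    rw [hopt]
    exact totalCostInf_stationaryPolicy_eq hKc hW.weaklyContinuous hβ measurable_excessCost φ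
      (fun y => (mem_argminInf_iff hK hα hW hα1 (φ.2.2 y)).1 (h y)) x

omit hW in
-- At a minimizing action the value is the shifted excess cost plus a nonnegative continuation. At
-- least one stage is needed, since the zero-horizon value is constant.
theorem AssumptionWu.infCompactOn_valueN (hWu : M.AssumptionWu) (n : ℕ) :
    InfCompactOn (M.valueN α (n + 1)) Set.univ := by
  have hW := hWu.assumptionWStar
  refine hWu.infCompactOn hK (lowerSemicontinuous_valueN hK hα hW (n + 1))
    (r := K * ∑ i ∈ Finset.range (n + 1), α ^ i) fun x => ?_
  obtain ⟨a, ha, h⟩ := (isLeast_valueN_and_argminN hK hα hW n).2.1 x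
  refine ⟨a, ha, ?_⟩
  rw [h, eta_valueN_eq hK hα hW n ha]
  exact (strictMono_shiftEReal _).monotone le_self_add

omit hW in
theorem AssumptionWu.infCompactOn_valueInf (hWu : M.AssumptionWu) (hα1 : α < 1) :
    InfCompactOn (M.valueInf α) Set.univ := by
  have hW := hWu.assumptionWStar
  refine hWu.infCompactOn hK (lowerSemicontinuous_valueInf hK hα hW hα1)
    (r := K * (1 - α)⁻¹) fun x => ?_
  obtain ⟨a, ha, h⟩ := (isLeast_valueInf_and_argminInf hK hα hW hα1).2.1 x
  refine ⟨a, ha, ?_⟩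
  rw [h, eta_valueInf_eq hK hα hW hα1 ha]
  exact (strictMono_shiftEReal _).monotone le_self_add

end MDP

end

theorem mainTheorem2 {𝒳 𝒜 : Type*}
    [TopologicalSpace 𝒳] [PolishSpace 𝒳] [MeasurableSpace 𝒳] [BorelSpace 𝒳]
    [TopologicalSpace 𝒜] [PolishSpace 𝒜] [MeasurableSpace 𝒜] [BorelSpace 𝒜]
    (X : Set 𝒳) (hX : MeasurableSet X) (A : Set 𝒜) (hA : MeasurableSet A)
    (M : MDP X A) (α : ℝ) (hα : 0 ≤ α) :
    (M.AssumptionWStar →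
      -- (i)
      ((∀ n, LowerSemicontinuous (M.valueN α n)) ∧
        (α < 1 →
          LowerSemicontinuous (M.valueInf α) ∧
          (∀ x, Tendsto (fun n => M.valueN α n x) atTop (𝓝 (M.valueInf α x))) ∧
          ((∀ p ∈ setGraph M.act, 0 ≤ M.cost p) →
            ∀ x, Monotone fun n => M.valueN α n x) ∧
          (∀ K : ℝ, (∀ p ∈ setGraph M.act, (K : EReal) ≤ M.cost p) →
            ∀ x, Monotone fun n =>
              M.valueN α n x - ((K * ∑ i ∈ Finset.range n, α ^ i : ℝ) : EReal)))) ∧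
      -- (ii)
      ((∀ x, M.valueN α 0 x = 0) ∧
        ∀ n,
          (∀ x, IsLeast (M.eta α (M.valueN α n) x '' M.act x) (M.valueN α (n + 1) x)) ∧
          (∀ x, (M.argminN α n x).Nonempty) ∧
          MeasurableSet (setGraph (M.argminN α n)) ∧
          (∀ x, M.valueN α (n + 1) x = ⊤ → M.argminN α n x = M.act x) ∧
          (∀ x, M.valueN α (n + 1) x < ⊤ → IsCompact (M.argminN α n x))) ∧
      -- (iii)
      (∀ N : ℕ, 1 ≤ N →
        (∃ φ : ℕ → M.Selector, MDP.IsHorizonOptimal α N (M.markovPolicy φ)) ∧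
        ∀ φ : ℕ → M.Selector,
          (∀ n < N, ∀ x, (φ (N - 1 - n)).1 x ∈ M.argminN α n x) →
            MDP.IsHorizonOptimal α N (M.markovPolicy φ)) ∧
      -- (iv)
      (α < 1 →
        (∀ x, IsLeast (M.eta α (M.valueInf α) x '' M.act x) (M.valueInf α x)) ∧
        (∀ x, (M.argminInf α x).Nonempty) ∧
        MeasurableSet (setGraph (M.argminInf α)) ∧
        (∀ x, M.valueInf α x = ⊤ → M.argminInf α x = M.act x) ∧
        (∀ x, M.valueInf α x < ⊤ → IsCompact (M.argminInf α x))) ∧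
      -- (v)
      (α < 1 →
        (∃ φ : M.Selector, MDP.IsDiscountOptimal α (M.stationaryPolicy φ)) ∧
        ∀ φ : M.Selector, MDP.IsDiscountOptimal α (M.stationaryPolicy φ) ↔
          ∀ x, φ.1 x ∈ M.argminInf α x)) ∧
    -- (vi)
    (M.AssumptionWu →
      (∀ n, 1 ≤ n → InfCompactOn (M.valueN α n) Set.univ) ∧
      (α < 1 → InfCompactOn (M.valueInf α) Set.univ)) := by
  obtain ⟨K, hK⟩ := M.cost_bddBelow
  refine ⟨fun hW => ⟨⟨MDP.lowerSemicontinuous_valueN hK hα hW, fun hα1 =>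
    ⟨MDP.lowerSemicontinuous_valueInf hK hα hW hα1, MDP.tendsto_valueN hK hα hW hα1,
      fun h0 x => ?_, fun K' hK' x => MDP.monotone_valueN_sub hK' hα x⟩⟩,
    ⟨fun x => ?_, MDP.isLeast_valueN_and_argminN hK hα hW⟩,
    fun N _ => ⟨MDP.exists_isHorizonOptimal_markovPolicy hK hα hW N,
      MDP.isHorizonOptimal_markovPolicy hK hα hW N⟩,
    MDP.isLeast_valueInf_and_argminInf hK hα hW,
    fun hα1 => ⟨MDP.exists_isDiscountOptimal_stationaryPolicy hK hα hW hα1,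
      MDP.isDiscountOptimal_stationaryPolicy_iff hK hα hW hα1⟩⟩,
    fun hWu => ⟨fun n hn => ?_, MDP.AssumptionWu.infCompactOn_valueInf hK hα hWu⟩⟩
  -- The lower bound zero makes the subtracted term vanish.
  · simpa using MDP.monotone_valueN_sub (K := 0) (by simpa using h0) hα x
  · simp [MDP.valueN_eq hK hα hW, MDP.iterValue, shiftEReal]
  · obtain ⟨m, rfl⟩ := Nat.exists_eq_add_of_le' hn
    exact MDP.AssumptionWu.infCompactOn_valueN hK hα hWu m
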